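/- Let $N\ge 1$. Consider the $2^N$-dimensional Hilbert space with orthonormal ("incoherent") basis $|\mathbf n\rangle$, $\mathbf n\in\{0,1\}^N$, and put $|\mathbf n|=\sum_l n_l$. For $\lambda\in[0,1]$ let $C[\lambda]$ be the matrix with entries $c_{\mathbf n\mathbf m}=\lambda^{(|\mathbf n|-|\mathbf m|)^2}$ (with $0^0=1$). For a matrix $C$ let $\mathcal C_C$ be the set of incoherent (diagonal) POVMs that are jointly measurable with the entrywise product $C*\mathsf Q=(C*\mathsf Q(i))_i$ for every POVM $\mathsf Q$ with finitely many outcomes. For $j=0,\dots,N$ let $\mathsf P(j)$ be the projection onto $\mathrm{span}\{|\mathbf n\rangle : |\mathbf n|=j\}$, and for $\alpha\in[0,1]$ let $\mathsf P_\alpha(j)=\alpha\,\mathsf P(j)+(1-\alpha)2^{-N}\mathrm{tr}[\mathsf P(j)]\,\mathbb 1$. Define $$\alpha_N(\lambda)=\max\{\alpha\in[0,1] : \mathsf P_\alpha\in\mathcal C_{C[\lambda]}\}.$$ With $c_k=\binom Nk 2^{-N}$ and $u_k(\alpha)=\sqrt{c_k(1-\alpha)\,(\alpha+c_k(1-\alpha))}$,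 let $$\beta_{01}(\alpha)=u_0(\alpha)+u_1(\alpha)+(1-\alpha)(1-c_0-c_1),$$ let $U_N=\beta_{01}^{-1}$, and let $k_N=2^{-N/2}(1+\sqrt N)$. Then: 1. The maximum defining $\alpha_N(\lambda)$ exists for every $\lambda\in[0,1]$, and $\alpha_N$ and $\beta_{01}$ are strictly decreasing bijections of $[0,1]$ onto itself, so that the inverses $\alpha_N^{-1}$ and $U_N=\beta_{01}^{-1}$ are well defined bijections of $[0,1]$. 2. The curves $\alpha=\alpha_N(\lambda)$ and $\alpha=U_N(\lambda)$ have the same asymptotic form $$\lambda=k_N\sqrt{1-\alpha}+O(1-\alpha)\qquad(\alpha\to1),$$ that is, both $\alpha_N^{-1}(\alpha)$ and $U_N^{-1}(\alpha)$ equal $k_N\sqrt{1-\alpha}+O(1-\alpha)$ as $\alpha\to 1$ from below. 3. For every $\alpha\in(0,1]$, $$\bigl|\alpha_N^{-1}(\alpha)-k_N\sqrt{1-\alpha}\bigr|\le 1-\alpha+\tfrac32 k_N\Bigl(\tfrac{1-\alpha}{\alpha}\Bigr)^{3/2}.$$ 4. If $N\ne2$, then for every $\alpha\in[0,1]$ one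 has $u_0(\alpha)+u_1(\alpha)\le\alpha_N^{-1}(\alpha)$, and for $\lambda=u_0(\alpha)+u_1(\alpha)$ there is a genuinely incoherent instrument with coherence matrix $C[\lambda]$ that measures $\mathsf P_\alpha$: that is, completely positive maps $\mathsf I_0,\dots,\mathsf I_N$ whose sum $\Lambda$ is trace preserving, fixes every $|\mathbf n\rangle\langle\mathbf n|$ and has dual $\Lambda^*(X)=C[\lambda]*X$, and with $\mathrm{tr}[\mathsf I_j(\rho)]=\mathrm{tr}[\mathsf P_\alpha(j)\rho]$ for all $j$ and $\rho$. -/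

import Mathlib

open scoped ComplexOrder Matrix Topology

namespace CoherenceIncompat

/-- A POVM (observable) with finite outcome set `Ω`: positive semidefinite matrices
summing to the identity. The incoherent basis is the standard basis indexed by `ι`. -/
def IsPOVM {ι Ω : Type*} [Fintype ι] [DecidableEq ι] [Fintype Ω]
    (M : Ω → Matrix ι ι ℂ) : Prop :=
  (∀ i, (M i).PosSemidef) ∧ ∑ i, M i = 1

/-- An observable is incoherent if all its matrices are diagonal. -/
def IsIncoherent {ι Ω : Type*} (P : Ω → Matrix ι ι ℂ) : Prop :=
  ∀ i, (P i).IsDiag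

/-- Joint measurability: existence of a joint observable with the given marginals. -/
def JointlyMeasurable {ι Ω₁ Ω₂ : Type*} [Fintype ι] [DecidableEq ι] [Fintype Ω₁] [Fintype Ω₂]
    (M : Ω₁ → Matrix ι ι ℂ) (F : Ω₂ → Matrix ι ι ℂ) : Prop :=
  ∃ G : Ω₁ × Ω₂ → Matrix ι ι ℂ, IsPOVM G ∧
    (∀ i, ∑ j, G (i, j) = M i) ∧ (∀ j, ∑ i, G (i, j) = F j)

/-- The set of incoherent observables (with outcome set `Ω`) that are jointly measurable with
the Hadamard product `C * Q` for every observable `Q` with finitely many outcomes. -/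
def compatSet {ι : Type*} [Fintype ι] [DecidableEq ι] (Ω : Type*) [Fintype Ω]
    (C : Matrix ι ι ℂ) : Set (Ω → Matrix ι ι ℂ) :=
  {P | IsPOVM P ∧ IsIncoherent P ∧
    ∀ (r : ℕ) (Q : Fin r → Matrix ι ι ℂ), IsPOVM Q →
      JointlyMeasurable (fun i => C ⊙ Q i) P}

/-! Genuinely incoherent instruments -/

/-- Complete positivity of a linear map `Φ` on matrices: every ampliation `id_k ⊗ Φ` preserves
positive semidefiniteness. -/
def IsCompletelyPositive {ι : Type*} (Φ : Matrix ι ι ℂ →ₗ[ℂ] Matrix ι ι ℂ) : Prop :=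
  ∀ (k : ℕ) (X : Matrix (Fin k × ι) (Fin k × ι) ℂ), X.PosSemidef →
    (Matrix.of fun p q : Fin k × ι =>
      Φ (Matrix.of fun a b : ι => X (p.1, a) (q.1, b)) p.2 q.2).PosSemidef

/-- An instrument (in the Schrödinger picture): completely positive maps whose sum is trace
preserving. -/
def IsInstrument {ι Ω : Type*} [Fintype ι] [Fintype Ω]
    (I : Ω → (Matrix ι ι ℂ →ₗ[ℂ] Matrix ι ι ℂ)) : Prop :=
  (∀ j, IsCompletelyPositive (I j)) ∧
    ∀ ρ : Matrix ι ι ℂ, Matrix.trace (∑ j, I j ρ) = Matrix.trace ρ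

/-- A genuinely incoherent instrument: its channel fixes every `|n⟩⟨n|`. -/
def IsGII {ι Ω : Type*} [Fintype ι] [DecidableEq ι] [Fintype Ω]
    (I : Ω → (Matrix ι ι ℂ →ₗ[ℂ] Matrix ι ι ℂ)) : Prop :=
  IsInstrument I ∧ ∀ n : ι, ∑ j, I j (Matrix.single n n 1) = Matrix.single n n 1

/-- `C` is the coherence matrix of `I`: the dual (Heisenberg) channel is `X ↦ C * X`
(Hadamard product). -/
def HasCoherenceMatrix {ι Ω : Type*} [Fintype ι] [Fintype Ω]
    (I : Ω → (Matrix ι ι ℂ →ₗ[ℂ] Matrix ι ι ℂ)) (C : Matrix ι ι ℂ) : Prop :=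
  ∀ X ρ : Matrix ι ι ℂ, Matrix.trace ((C ⊙ X) * ρ) = Matrix.trace (X * ∑ j, I j ρ)

/-- `P` is the observable measured by `I`: outcome probabilities are `tr (P j ρ)`. -/
def Measures {ι Ω : Type*} [Fintype ι]
    (I : Ω → (Matrix ι ι ℂ →ₗ[ℂ] Matrix ι ι ℂ)) (P : Ω → Matrix ι ι ℂ) : Prop :=
  ∀ j, ∀ ρ : Matrix ι ι ℂ, Matrix.trace (I j ρ) = Matrix.trace (P j * ρ)

/-! The spin-boson model of `N` qubits -/

/-- Number of ones in a bit string. -/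
def ones {N : ℕ} (n : Fin N → Fin 2) : ℕ := ∑ l, (n l : ℕ)

/-- The coherence matrix `c_{n,m} = lam ^ ((|n| - |m|)^2)` (with `0 ^ 0 = 1`). -/
noncomputable def spinBoson (N : ℕ) (lam : ℝ) : Matrix (Fin N → Fin 2) (Fin N → Fin 2) ℂ :=
  Matrix.of fun n m => ((lam ^ (((ones n : ℤ) - (ones m : ℤ)).natAbs ^ 2) : ℝ) : ℂ)

/-- The projection onto the span of the basis vectors with exactly `j` ones; the spectral
resolution of the system Hamiltonian. -/
def dfsProj (N : ℕ) (j : Fin (N + 1)) : Matrix (Fin N → Fin 2) (Fin N → Fin 2) ℂ :=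
  Matrix.diagonal fun n => if ones n = (j : ℕ) then 1 else 0

/-- The depolarisation of `dfsProj`. -/
noncomputable def dfsDep (N : ℕ) (j : Fin (N + 1)) :
    Matrix (Fin N → Fin 2) (Fin N → Fin 2) ℂ :=
  (((2 : ℂ) ^ N)⁻¹ * Matrix.trace (dfsProj N j)) • (1 : Matrix (Fin N → Fin 2) (Fin N → Fin 2) ℂ)

/-- The `α`-weighted average of `dfsProj` and its depolarisation. -/
noncomputable def dfsMix (N : ℕ) (α : ℝ) (j : Fin (N + 1)) :
    Matrix (Fin N → Fin 2) (Fin N → Fin 2) ℂ :=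
  (α : ℂ) • dfsProj N j + ((1 - α : ℝ) : ℂ) • dfsDep N j

/-- The weights `α ∈ [0, 1]` for which the mixed observable has no incompatibility due to the
spin-boson coherence pattern. -/
def compatWeights (N : ℕ) (lam : ℝ) : Set ℝ :=
  {α | α ∈ Set.Icc (0 : ℝ) 1 ∧ dfsMix N α ∈ compatSet (Fin (N + 1)) (spinBoson N lam)}

/-- The critical weight `α_N(lam)`, the largest element of `compatWeights N lam`. -/
noncomputable def alphaN (N : ℕ) (lam : ℝ) : ℝ := sSup (compatWeights N lam)

/-- The binomial ("coin toss") probabilities. -/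
noncomputable def coin (N k : ℕ) : ℝ := (N.choose k : ℝ) / 2 ^ N

/-- `β_{k,k'}(α)`, which for `k ≠ k'` is one minus the squared Hellinger distance between the
distributions of the mixed observable at `k` and `k'`. -/
noncomputable def beta (N k k' : ℕ) (α : ℝ) : ℝ :=
  1 - α
    + (√(coin N k * (1 - α) * (α + coin N k * (1 - α))) - coin N k * (1 - α))
    + (√(coin N k' * (1 - α) * (α + coin N k' * (1 - α))) - coin N k' * (1 - α))

/-- The inverse of a bijection of `[0, 1]` onto itself. -/
noncomputable def unitInv (f : ℝ → ℝ) : ℝ → ℝ := Function.invFunOn f (Set.Icc 0 1)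

/-- The upper bound `U_N`, the inverse function of `β_{01}`. -/
noncomputable def upperN (N : ℕ) : ℝ → ℝ := unitInv (beta N 0 1)

/-- `k_N = (1 + √N) 2^{-N/2}`. -/
noncomputable def kN (N : ℕ) : ℝ := (1 + √(N : ℝ)) / (2 : ℝ) ^ ((N : ℝ) / 2)

/-- `√(q (α + q))` with `q = c_N(k) (1 - α)`. -/
noncomputable def uN (N k : ℕ) (α : ℝ) : ℝ :=
  √(coin N k * (1 - α) * (α + coin N k * (1 - α)))

end CoherenceIncompat

/-!
Compatibility with `C` means that `C` is a sum of positive semidefinite matrices whose diagonals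
are the outcome probabilities: test it on the uniform sign observable, or conversely form the
joint observable from entrywise products. Permutation symmetry reduces this to the `N + 1` levels
`|n| = k`, with the Gaussian kernel `lam ^ (k - l) ^ 2`.

Gaussian kernels are positive definite and closed under entrywise products. This makes the set of
compatible pairs `(α, lam)` compact and monotone, so that its boundary curve `α_N` is continuous
and strictly decreasing. The `2 × 2` minors on the levels `0`, `1` force
`lam ≤ β₀₁ α ≤ k_N √(1 - α) + (1 - α)`. In the other direction an explicit splitting exists at
`lam = u₀ + u₁ ≥ k_N √(1 - α) - k_N (1 - α) ^ (3 / 2)`, except that for `N = 2` the parameter has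
to be lowered by a term of order `(1 - α) ^ (3 / 2)`.
-/

namespace CoherenceIncompat

/-! ### Positive semidefinite matrices -/

section PosSemidef

open Matrix

variable {n 𝕜 : Type*} [RCLike 𝕜]

lemma sq_apply_le_of_posSemidef {A : Matrix n n ℝ} (hA : A.PosSemidef) (k l : n) :
    A k l ^ 2 ≤ A k k * A l l := by
  have hdet := (hA.submatrix ![k, l]).det_nonneg
  have hsymm : A l k = A k l := by simpa using hA.isHermitian.apply k l
  simp only [det_fin_two, submatrix_apply, cons_val_zero, cons_val_one, hsymm] at hdet
  linarith [sq (A k l)]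

lemma star_dotProduct_mulVec_eq_sum [Fintype n] (A : Matrix n n ℝ) (x : n → ℝ) :
    star x ⬝ᵥ (A *ᵥ x) = ∑ k, ∑ l, A k l * x k * x l := by
  simp only [star_trivial, dotProduct, mulVec, Finset.mul_sum]
  exact Finset.sum_congr rfl fun k _ => Finset.sum_congr rfl fun l _ => by ring

lemma posSemidef_iff_isSymm_and_sum_nonneg [Fintype n] {A : Matrix n n ℝ} :
    A.PosSemidef ↔ A.IsSymm ∧ ∀ x : n → ℝ, 0 ≤ ∑ k, ∑ l, A k l * x k * x l := by
  simp only [posSemidef_iff_dotProduct_mulVec, star_dotProduct_mulVec_eq_sum, IsHermitian, IsSymm,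
    conjTranspose_eq_transpose_of_trivial]

variable [Finite n]

lemma posSemidef_map_ofReal {A : Matrix n n ℝ} (hA : A.PosSemidef) :
    (A.map ((↑) : ℝ → 𝕜)).PosSemidef := by
  classical
  have := Fintype.ofFinite n
  obtain ⟨B, rfl⟩ : ∃ B : Matrix n n ℝ, A = Bᴴ * B := by
    open scoped MatrixOrder in
    exact CStarAlgebra.nonneg_iff_eq_star_mul_self.mp hA.nonneg
  have hmap : (Bᴴ * B).map ((↑) : ℝ → 𝕜) = (B.map (↑))ᴴ * B.map ((↑) : ℝ → 𝕜) := by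
    ext i j
    simp [mul_apply]
  exact hmap ▸ posSemidef_conjTranspose_mul_self _

lemma posSemidef_map_re {A : Matrix n n 𝕜} (hA : A.PosSemidef) :
    (A.map RCLike.re).PosSemidef := by
  have := Fintype.ofFinite n
  refine .of_dotProduct_mulVec_nonneg ?_ fun x => ?_
  · ext i j
    simp [← hA.isHermitian.apply i j]
  · have hre := (RCLike.le_iff_re_im.mp (hA.dotProduct_mulVec_nonneg fun i => (x i : 𝕜))).1
    simpa [dotProduct, mulVec] using hre

lemma isClosed_setOf_posSemidef : IsClosed {A : Matrix n n ℝ | A.PosSemidef} := by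
  have := Fintype.ofFinite n
  simp only [posSemidef_iff_isSymm_and_sum_nonneg, Set.ofPred_and, Set.ofPred_forall, IsSymm]
  exact (isClosed_eq (by fun_prop) (by fun_prop)).inter
    (isClosed_iInter fun x => isClosed_le (by fun_prop) (by fun_prop))

lemma eventually_posSemidef_of_posDef {A : Matrix n n ℝ} (hA : A.PosDef) :
    ∀ᶠ B in 𝓝 A, B.IsSymm → B.PosSemidef := by
  have := Fintype.ofFinite n
  have hsphere : ∀ᶠ B in 𝓝 A, ∀ x ∈ Metric.sphere (0 : n → ℝ) 1, 0 < x ⬝ᵥ (B *ᵥ x) := by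
    refine (isCompact_sphere _ _).eventually_forall_of_forall_eventually fun x hx => ?_
    have hx0 : x ≠ 0 := ne_zero_of_mem_unit_sphere (⟨x, hx⟩ : Metric.sphere (0 : n → ℝ) 1)
    have hcont : Continuous fun p : Matrix n n ℝ × (n → ℝ) => p.2 ⬝ᵥ (p.1 *ᵥ p.2) := by fun_prop
    exact hcont.continuousAt.eventually_const_lt (hA.dotProduct_mulVec_pos hx0)
  filter_upwards [hsphere] with B hB hsymm
  refine .of_dotProduct_mulVec_nonneg ?_ fun x => ?_
  · rwa [IsHermitian, conjTranspose_eq_transpose_of_trivial]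
  · rcases eq_or_ne x 0 with rfl | hx
    · simp
    · have hunit := hB (‖x‖⁻¹ • x) (by simp [norm_smul, hx])
      rw [mulVec_smul, dotProduct_smul, smul_dotProduct] at hunit
      simp only [smul_eq_mul, ← mul_assoc] at hunit
      exact (pos_of_mul_pos_right hunit (by positivity)).le

end PosSemidef

/-! ### Splitting a matrix into positive semidefinite parts -/

section HasSplitting

open Matrix

variable {ι κ Ω 𝕜 : Type*} [Fintype Ω] [RCLike 𝕜]

/-- `HasSplitting C p`: the matrix `C` is a sum of positive semidefinite matrices, indexed by the
outcomes, with prescribed diagonals `p j`. For `p` the diagonals of an incoherent observable this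
is compatibility with the coherence pattern `C`, see `mem_compatSet_iff`. -/
def HasSplitting (C : Matrix ι ι 𝕜) (p : Ω → ι → 𝕜) : Prop :=
  ∃ D : Ω → Matrix ι ι 𝕜, (∀ j, (D j).PosSemidef) ∧ ∑ j, D j = C ∧ ∀ j, (D j).diag = p j

variable {C C' : Matrix ι ι 𝕜} {p p' : Ω → ι → 𝕜}

lemma HasSplitting.submatrix (h : HasSplitting C p) (f : κ → ι) :
    HasSplitting (C.submatrix f f) fun j => p j ∘ f := by
  obtain ⟨D, hD, rfl, hp⟩ := h
  refine ⟨fun j => (D j).submatrix f f, fun j => (hD j).submatrix f, ?_, fun j => ?_⟩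
  · ext
    simp [Matrix.sum_apply]
  · ext k
    simp [← hp j]

lemma HasSplitting.add (h : HasSplitting C p) (h' : HasSplitting C' p') :
    HasSplitting (C + C') (p + p') := by
  obtain ⟨D, hD, rfl, hp⟩ := h
  obtain ⟨D', hD', rfl, hp'⟩ := h'
  exact ⟨D + D', fun j => (hD j).add (hD' j), Finset.sum_add_distrib,
    fun j => by simp [hp, hp']⟩

lemma HasSplitting.hadamard (h : HasSplitting C p) {A : Matrix ι ι 𝕜} (hA : A.PosSemidef) :
    HasSplitting (C ⊙ A) fun j k => p j k * A k k := by
  obtain ⟨D, hD, rfl, hp⟩ := h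
  refine ⟨fun j => D j ⊙ A, fun j => (hD j).hadamard hA, ?_, fun j => ?_⟩
  · ext
    simp [Matrix.sum_apply, Finset.sum_mul]
  · ext k
    simp [← hp j]

lemma hasSplitting_of_weights {A : Matrix ι ι ℝ} (hA : A.PosSemidef) {w : Ω → ℝ}
    (hw : ∀ j, 0 ≤ w j) (hsum : ∑ j, w j = 1) : HasSplitting A fun j k => w j * A k k :=
  ⟨fun j => w j • A, fun j => hA.smul (hw j), by rw [← Finset.sum_smul, hsum, one_smul],
    fun _ => rfl⟩

lemma HasSplitting.smul {C : Matrix ι ι ℝ} {p : Ω → ι → ℝ} (h : HasSplitting C p) {t : ℝ}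
    (ht : 0 ≤ t) : HasSplitting (t • C) (t • p) := by
  obtain ⟨D, hD, rfl, hp⟩ := h
  exact ⟨t • D, fun j => (hD j).smul ht, by simp [Finset.smul_sum], fun j => by simp [hp]⟩

lemma hasSplitting_diagonal [DecidableEq ι] {p : Ω → ι → ℝ} (hp : ∀ j, 0 ≤ p j) :
    HasSplitting (diagonal (∑ j, p j)) p :=
  ⟨fun j => diagonal (p j), fun j => .diagonal (hp j),
    (map_sum (diagonalAddMonoidHom ι ℝ) p Finset.univ).symm, fun _ => diag_diagonal _⟩

variable [Finite ι]

lemma HasSplitting.map_ofReal {C : Matrix ι ι ℝ} {p : Ω → ι → ℝ} (h : HasSplitting C p) :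
    HasSplitting (C.map ((↑) : ℝ → 𝕜)) fun j k => (p j k : 𝕜) := by
  obtain ⟨D, hD, rfl, hp⟩ := h
  refine ⟨fun j => (D j).map (↑), fun j => posSemidef_map_ofReal (hD j), ?_, fun j => ?_⟩
  · ext
    simp [Matrix.sum_apply]
  · ext k
    simp [← hp j]

lemma HasSplitting.map_re (h : HasSplitting C p) :
    HasSplitting (C.map RCLike.re) fun j k => RCLike.re (p j k) := by
  obtain ⟨D, hD, rfl, hp⟩ := h
  refine ⟨fun j => (D j).map RCLike.re, fun j => posSemidef_map_re (hD j), ?_, fun j => ?_⟩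
  · ext
    simp [Matrix.sum_apply]
  · ext k
    simp [← hp j]

lemma isCompact_setOf_posSemidef_sum_diag_eq_one :
    IsCompact {D : Ω → Matrix ι ι ℝ | (∀ j, (D j).PosSemidef) ∧ ∑ j, (D j).diag = 1} := by
  have := Fintype.ofFinite ι
  have hclosed : IsClosed {D : Ω → Matrix ι ι ℝ |
      (∀ j, (D j).PosSemidef) ∧ ∑ j, (D j).diag = 1} := by
    simp only [Set.ofPred_and, Set.ofPred_forall]
    exact (isClosed_iInter fun j => isClosed_setOf_posSemidef.preimage (continuous_apply j)).inter
      (isClosed_eq (f := fun D : Ω → Matrix ι ι ℝ => ∑ j, (D j).diag) (by fun_prop)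
        continuous_const)
  refine (isCompact_univ_pi fun _ : Ω => isCompact_univ_pi fun _ : ι => isCompact_univ_pi
    fun _ : ι => isCompact_Icc (a := (-1 : ℝ)) (b := 1)).of_isClosed_subset hclosed ?_
  rintro D ⟨hD, hsum⟩ j - k - l -
  have hdiag (k : ι) : D j k k ≤ 1 := by
    have hk : ∑ i, D i k k = 1 := by simpa [diag] using congrFun hsum k
    exact hk ▸ Finset.single_le_sum (f := fun i => D i k k) (fun i _ => (hD i).diag_nonneg)
      (Finset.mem_univ j)
  refine abs_le.1 ((sq_le_one_iff_abs_le_one _).1 ?_)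
  exact (sq_apply_le_of_posSemidef (hD j) k l).trans
    (mul_le_one₀ (hdiag k) (hD j).diag_nonneg (hdiag l))

lemma isCompact_setOf_hasSplitting_sum_eq_one :
    IsCompact {q : Matrix ι ι ℝ × (Ω → ι → ℝ) | HasSplitting q.1 q.2 ∧ ∑ j, q.2 j = 1} := by
  convert isCompact_setOf_posSemidef_sum_diag_eq_one (ι := ι) (Ω := Ω) |>.image
    (f := fun D => (∑ j, D j, fun j => (D j).diag)) (by fun_prop)
  ext ⟨C, p⟩
  constructor
  · rintro ⟨⟨D, hD, hC, hp⟩, hsum⟩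
    exact ⟨D, ⟨hD, by simpa only [hp] using hsum⟩, Prod.ext hC (funext hp)⟩
  · rintro ⟨D, ⟨hD, hsum⟩, hq⟩
    obtain ⟨rfl, rfl⟩ := Prod.mk.inj hq
    exact ⟨⟨D, hD, rfl, fun _ => rfl⟩, hsum⟩

end HasSplitting

/-! ### Compatibility with a Hadamard channel -/

section Compat

open Matrix

variable {ι Ω : Type*} [Fintype Ω]

/-- The rank-one matrix `s sᵀ` of a sign vector `s`. -/
def signMatrix (s : ι → ℤˣ) : Matrix ι ι ℂ :=
  vecMulVec (fun n => ((s n : ℤ) : ℂ)) (star fun n => ((s n : ℤ) : ℂ))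

lemma signMatrix_apply (s : ι → ℤˣ) (n m : ι) :
    signMatrix s n m = ((s n * s m : ℤˣ) : ℤ) := by
  simp [signMatrix, vecMulVec_apply]

lemma posSemidef_signMatrix [Finite ι] (s : ι → ℤˣ) : (signMatrix s).PosSemidef :=
  posSemidef_vecMulVec_self_star _

lemma signMatrix_diag (s : ι → ℤˣ) (n : ι) : signMatrix s n n = 1 := by
  simp [signMatrix_apply]

lemma signMatrix_hadamard_self (s : ι → ℤˣ) : signMatrix s ⊙ signMatrix s = of 1 := by
  ext n m
  rw [hadamard_apply, signMatrix_apply, ← Int.cast_mul, ← Units.val_mul, Int.units_mul_self]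
  simp

variable [Fintype ι] [DecidableEq ι]

lemma sum_signMatrix : ∑ s : ι → ℤˣ, signMatrix s = (2 : ℂ) ^ Fintype.card ι • 1 := by
  ext n m
  rw [Matrix.sum_apply, Matrix.smul_apply, one_apply]
  rcases eq_or_ne n m with rfl | hnm
  · simp [signMatrix_diag]
  let χ : (ι → ℤˣ) →* ℤ :=
    (Units.coeHom ℤ).comp (Pi.evalMonoidHom (fun _ => ℤˣ) n * Pi.evalMonoidHom (fun _ => ℤˣ) m)
  have hχ : χ ≠ 1 := fun h => by
    simpa [χ, Pi.mulSingle_eq_of_ne' hnm] using DFunLike.congr_fun h (Pi.mulSingle n (-1))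
  have hsum : ∑ s, ((χ s : ℤ) : ℂ) = 0 := mod_cast sum_hom_units_eq_zero χ hχ
  simpa [signMatrix_apply, hnm, χ] using hsum

lemma isPOVM_signMatrix :
    IsPOVM fun s : ι → ℤˣ => ((2 : ℂ) ^ Fintype.card ι)⁻¹ • signMatrix s := by
  refine ⟨fun s => (posSemidef_signMatrix s).smul ?_, ?_⟩
  · exact inv_nonneg.2 (pow_nonneg zero_le_two _)
  · rw [← Finset.smul_sum, sum_signMatrix, smul_smul, inv_mul_cancel₀ (by simp), one_smul]

lemma sum_hadamard_of_isPOVM {Q : Ω → Matrix ι ι ℂ} (hQ : IsPOVM Q) (A : Matrix ι ι ℂ) :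
    ∑ i, Q i ⊙ A = diagonal A.diag := by
  rw [← one_hadamard, ← hQ.2]
  ext
  simp [Matrix.sum_apply, Finset.sum_mul]

lemma jointlyMeasurable_of_mem_compatSet {C : Matrix ι ι ℂ} {P : Ω → Matrix ι ι ℂ}
    (hP : P ∈ compatSet Ω C) {Ω' : Type*} [Fintype Ω'] {Q : Ω' → Matrix ι ι ℂ} (hQ : IsPOVM Q) :
    JointlyMeasurable (fun i => C ⊙ Q i) P := by
  let e := Fintype.equivFin Ω'
  obtain ⟨G, hG, hG₁, hG₂⟩ := hP.2.2 _ (Q ∘ e.symm)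
    ⟨fun i => hQ.1 _, (e.symm.sum_comp Q).trans hQ.2⟩
  refine ⟨fun ij => G (e ij.1, ij.2), ⟨fun ij => hG.1 _, ?_⟩, fun i => ?_, fun j => ?_⟩
  · exact ((e.prodCongr (Equiv.refl Ω)).sum_comp G).trans hG.2
  · simp [hG₁]
  · exact (e.sum_comp fun i => G (i, j)).trans (hG₂ j)

-- Test compatibility on the sign observable `2⁻ᵈ s sᵀ`: multiplying the joint effects entrywise by
-- `s sᵀ` undoes the signs, and what is left no longer depends on the tested observable.
lemma hasSplitting_of_mem_compatSet {C : Matrix ι ι ℂ} {P : Ω → Matrix ι ι ℂ}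
    (hP : P ∈ compatSet Ω C) : HasSplitting C fun j => (P j).diag := by
  obtain ⟨G, hG, hG₁, hG₂⟩ := jointlyMeasurable_of_mem_compatSet hP isPOVM_signMatrix
  beta_reduce at hG₁
  refine ⟨fun j => ∑ s, signMatrix s ⊙ G (s, j), fun j => posSemidef_sum _ fun s _ =>
    (posSemidef_signMatrix s).hadamard (hG.1 _), ?_, fun j => ?_⟩
  · have hmarginal (s : ι → ℤˣ) :
        ∑ j, signMatrix s ⊙ G (s, j) = ((2 : ℂ) ^ Fintype.card ι)⁻¹ • C := by
      calc ∑ j, signMatrix s ⊙ G (s, j) = signMatrix s ⊙ ∑ j, G (s, j) := by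
            ext
            simp [Matrix.sum_apply, Finset.mul_sum]
        _ = ((2 : ℂ) ^ Fintype.card ι)⁻¹ • C := by
            rw [hG₁ s, hadamard_smul, hadamard_smul, hadamard_comm C, ← hadamard_assoc,
              signMatrix_hadamard_self, of_one_hadamard]
    rw [Finset.sum_comm, Finset.sum_congr rfl fun s _ => hmarginal s]
    simp [← Nat.cast_smul_eq_nsmul ℂ, smul_smul]
  · ext n
    simp [← hG₂ j, Matrix.sum_apply, signMatrix_diag]

lemma mem_compatSet_of_hasSplitting {C : Matrix ι ι ℂ} {P : Ω → Matrix ι ι ℂ} (hP : IsPOVM P)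
    (hdiag : IsIncoherent P) (h : HasSplitting C fun j => (P j).diag) : P ∈ compatSet Ω C := by
  obtain ⟨D, hD, rfl, hDP⟩ := h
  refine ⟨hP, hdiag, fun r Q hQ => ?_⟩
  have hcol (j : Ω) : ∑ i, Q i ⊙ D j = P j := by
    rw [sum_hadamard_of_isPOVM hQ, hDP, (hdiag j).diagonal_diag]
  refine ⟨fun ij => Q ij.1 ⊙ D ij.2, ⟨fun ij => (hQ.1 _).hadamard (hD _), ?_⟩, fun i => ?_, hcol⟩
  · rw [Fintype.sum_prod_type_right, Finset.sum_congr rfl fun j _ => hcol j, hP.2]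
  · ext
    simp [Matrix.sum_apply, Finset.mul_sum, mul_comm]

theorem mem_compatSet_iff {C : Matrix ι ι ℂ} {P : Ω → Matrix ι ι ℂ} :
    P ∈ compatSet Ω C ↔ IsPOVM P ∧ IsIncoherent P ∧ HasSplitting C fun j => (P j).diag :=
  ⟨fun h => ⟨h.1, h.2.1, hasSplitting_of_mem_compatSet h⟩,
    fun ⟨hP, hdiag, h⟩ => mem_compatSet_of_hasSplitting hP hdiag h⟩

end Compat

/-! ### Genuinely incoherent instruments -/

section Instrument

open Matrix

variable {ι Ω : Type*}

/-- Entrywise multiplication by a fixed matrix, as a linear map: the Schrödinger picture of the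
parts of a genuinely incoherent instrument. -/
def hadamardLeft (A : Matrix ι ι ℂ) : Matrix ι ι ℂ →ₗ[ℂ] Matrix ι ι ℂ where
  toFun X := A ⊙ X
  map_add' X Y := hadamard_add A X Y
  map_smul' c X := hadamard_smul A X c

@[simp] lemma hadamardLeft_apply (A X : Matrix ι ι ℂ) : hadamardLeft A X = A ⊙ X := rfl

lemma isCompletelyPositive_hadamardLeft {A : Matrix ι ι ℂ} (hA : A.PosSemidef) :
    IsCompletelyPositive (hadamardLeft A) :=
  fun _ _ hX => (hA.submatrix Prod.snd).hadamard hX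

variable [Fintype ι] [Fintype Ω] [DecidableEq ι]

theorem exists_isGII_of_mem_compatSet {C : Matrix ι ι ℂ} {P : Ω → Matrix ι ι ℂ}
    (hP : P ∈ compatSet Ω C) :
    ∃ I : Ω → (Matrix ι ι ℂ →ₗ[ℂ] Matrix ι ι ℂ),
      IsGII I ∧ HasCoherenceMatrix I C ∧ Measures I P := by
  obtain ⟨hPOVM, hdiag, D, hD, rfl, hDP⟩ := mem_compatSet_iff.1 hP
  have hDP' (j : Ω) (n : ι) : D j n n = P j n n := congrFun (hDP j) n
  have hone (n : ι) : ∑ j, D j n n = 1 := by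
    have hentry := congrFun (congrFun hPOVM.2 n) n
    simpa only [Matrix.sum_apply, one_apply_eq, ← hDP'] using hentry
  have hsum (X : Matrix ι ι ℂ) : ∑ j, hadamardLeft (D j)ᵀ X = (∑ j, D j)ᵀ ⊙ X := by
    ext
    simp [Matrix.sum_apply, Finset.sum_mul]
  -- The trace pairing `tr (X Y)` transposes entrywise products, whence the transposes.
  refine ⟨fun j => hadamardLeft (D j)ᵀ,
    ⟨⟨fun j => isCompletelyPositive_hadamardLeft (hD j).transpose, fun X => ?_⟩, fun n => ?_⟩,
    fun X Y => ?_, fun j X => ?_⟩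
  · rw [hsum]
    simp [trace, Matrix.sum_apply, hone]
  · rw [hsum]
    ext a b
    by_cases h : n = a ∧ n = b
    · obtain ⟨rfl, rfl⟩ := h
      simp [Matrix.sum_apply, hone]
    · simp [h]
  · rw [hsum]
    simp only [trace, diag_apply, mul_apply, hadamard_apply, transpose_apply]
    exact Finset.sum_congr rfl fun n _ => Finset.sum_congr rfl fun m _ => by ring
  · rw [← (hdiag j).diagonal_diag]
    simp [trace, diagonal_mul, hDP']

end Instrument

/-! ### Reduction to the levels of the spin-boson model -/

section Levels

open Matrix

/-- The coherence matrix `lam ^ (k - l) ^ 2` of the spin-boson model on the levels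
`0, …, N`, i.e. with one basis vector for every number of ones. -/
noncomputable def gauss (N : ℕ) (lam : ℝ) : Matrix (Fin (N + 1)) (Fin (N + 1)) ℝ :=
  of fun k l => lam ^ (((k : ℤ) - (l : ℤ)).natAbs ^ 2)

/-- The probability of outcome `j` of the mixed observable on level `k`. -/
noncomputable def mixProb (N : ℕ) (α : ℝ) (j k : Fin (N + 1)) : ℝ :=
  (if k = j then α else 0) + (1 - α) * coin N j

/-- Compatibility of the mixed observable of weight `α` with the spin-boson coherence pattern
of parameter `lam`, stated on the levels; see `mem_compatWeights_iff`. -/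
def Splits (N : ℕ) (α lam : ℝ) : Prop := HasSplitting (gauss N lam) (mixProb N α)

lemma ones_le {N : ℕ} (n : Fin N → Fin 2) : ones n ≤ N := by
  calc ones n ≤ ∑ _l : Fin N, 1 := Finset.sum_le_sum fun l _ => by lia
    _ = N := by simp

/-- The level of a bit string, its number of ones as an element of `{0, …, N}`. -/
def level {N : ℕ} (n : Fin N → Fin 2) : Fin (N + 1) := ⟨ones n, Nat.lt_succ_of_le (ones_le n)⟩

/-- The bit strings of length `N` as subsets of `{0, …, N - 1}`. -/
def bitsEquiv (N : ℕ) : (Fin N → Fin 2) ≃ Finset (Fin N) where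
  toFun n := {l | n l = 1}
  invFun s l := if l ∈ s then 1 else 0
  left_inv n := by
    ext l
    obtain h | h : n l = 0 ∨ n l = 1 := by lia
    all_goals simp [h]
  right_inv s := by ext; simp

lemma card_bitsEquiv {N : ℕ} (n : Fin N → Fin 2) : (bitsEquiv N n).card = ones n := by
  rw [ones, bitsEquiv, Equiv.coe_fn_mk, Finset.card_filter]
  refine Finset.sum_congr rfl fun l _ => ?_
  obtain h | h : n l = 0 ∨ n l = 1 := by lia
  all_goals simp [h]

lemma card_filter_ones_eq (N j : ℕ) :
    (Finset.univ.filter fun n : Fin N → Fin 2 => ones n = j).card = N.choose j := by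
  calc _ = (Finset.powersetCard j (Finset.univ : Finset (Fin N))).card :=
        Finset.card_equiv (bitsEquiv N) fun n => by simp [Finset.mem_powersetCard, card_bitsEquiv]
    _ = N.choose j := by simp

lemma level_surjective (N : ℕ) : Function.Surjective (level (N := N)) := by
  intro k
  have hpos : 0 < (Finset.univ.filter fun n : Fin N → Fin 2 => ones n = k).card := by
    rw [card_filter_ones_eq]
    exact Nat.choose_pos (Nat.le_of_lt_succ k.2)
  obtain ⟨n, hn⟩ := Finset.card_pos.mp hpos
  exact ⟨n, Fin.ext (Finset.mem_filter.mp hn).2⟩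

lemma spinBoson_eq (N : ℕ) (lam : ℝ) :
    spinBoson N lam = ((gauss N lam).map ((↑) : ℝ → ℂ)).submatrix level level := rfl

lemma dfsMix_eq_diagonal (N : ℕ) (α : ℝ) (j : Fin (N + 1)) :
    dfsMix N α j = diagonal fun n => (mixProb N α j (level n) : ℂ) := by
  have htrace : trace (dfsProj N j) = (N.choose j : ℂ) := by
    rw [dfsProj, trace_diagonal, Finset.sum_boole, card_filter_ones_eq]
  have hlevel (n : Fin N → Fin 2) : ones n = (j : ℕ) ↔ level n = j :=
    (Fin.ext_iff (a := level n)).symm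
  ext n m
  rcases eq_or_ne n m with rfl | hnm
  · simp only [dfsMix, dfsDep, htrace]
    simp [dfsProj, mixProb, coin, hlevel, div_eq_inv_mul, apply_ite ((↑) : ℝ → ℂ)]
  · simp [dfsMix, dfsDep, dfsProj, hnm]

lemma coin_nonneg (N k : ℕ) : 0 ≤ coin N k := by
  unfold coin
  positivity

lemma coin_pos {N k : ℕ} (h : k ≤ N) : 0 < coin N k :=
  div_pos (mod_cast Nat.choose_pos h) (by positivity)

lemma sum_coin (N : ℕ) : ∑ j : Fin (N + 1), coin N j = 1 := by
  simp_rw [Fin.sum_univ_eq_sum_range (fun j => coin N j), coin]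
  rw [← Finset.sum_div, div_eq_one_iff_eq (by positivity)]
  exact_mod_cast Nat.sum_range_choose N

lemma mixProb_nonneg {N : ℕ} {α : ℝ} (hα : α ∈ Set.Icc (0 : ℝ) 1) (j k : Fin (N + 1)) :
    0 ≤ mixProb N α j k :=
  add_nonneg (ite_nonneg hα.1 le_rfl) (mul_nonneg (sub_nonneg.2 hα.2) (coin_nonneg N j))

lemma sum_mixProb (N : ℕ) (α : ℝ) : ∑ j, mixProb N α j = 1 := by
  ext k
  simp [mixProb, Finset.sum_add_distrib, ← Finset.mul_sum, sum_coin]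

lemma isPOVM_dfsMix {N : ℕ} {α : ℝ} (hα : α ∈ Set.Icc (0 : ℝ) 1) : IsPOVM (dfsMix N α) := by
  refine ⟨fun j => ?_, ?_⟩
  · rw [dfsMix_eq_diagonal]
    exact .diagonal fun n => Complex.zero_le_real.2 (mixProb_nonneg hα _ _)
  · have hsum (n : Fin N → Fin 2) : ∑ j, mixProb N α j (level n) = 1 := by
      simpa using congrFun (sum_mixProb N α) (level n)
    ext n m
    rcases eq_or_ne n m with rfl | hnm
    · simp [dfsMix_eq_diagonal, Matrix.sum_apply, ← Complex.ofReal_sum, hsum]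
    · simp [dfsMix_eq_diagonal, Matrix.sum_apply, hnm]

lemma isIncoherent_dfsMix (N : ℕ) (α : ℝ) : IsIncoherent (dfsMix N α) := fun j => by
  rw [dfsMix_eq_diagonal]
  exact isDiag_diagonal _

theorem mem_compatWeights_iff {N : ℕ} {lam α : ℝ} :
    α ∈ compatWeights N lam ↔ α ∈ Set.Icc (0 : ℝ) 1 ∧ Splits N α lam := by
  refine and_congr_right fun hα => ?_
  have hdiag : (fun j => (dfsMix N α j).diag) = fun j n => ((mixProb N α j (level n) : ℝ) : ℂ) := by
    simp only [dfsMix_eq_diagonal, diag_diagonal]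
  rw [mem_compatSet_iff, hdiag, spinBoson_eq]
  constructor
  · rintro ⟨-, -, h⟩
    choose rep hrep using level_surjective N
    have hcomp := (h.submatrix rep).map_re
    simp only [submatrix_submatrix, submatrix_map, map_map, Function.comp_def, hrep] at hcomp
    simpa [Splits, ← Function.id_def] using hcomp
  · intro h
    exact ⟨isPOVM_dfsMix hα, isIncoherent_dfsMix N α, h.map_ofReal.submatrix level⟩

end Levels

/-! ### Gaussian kernels -/

section Gauss

open Matrix

lemma hasSum_quadratic_form_exp {n : Type*} [Fintype n] (x v : n → ℝ) :
    HasSum (fun m : ℕ => (m.factorial : ℝ)⁻¹ * (∑ k, v k * x k ^ m) ^ 2)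
      (∑ k, ∑ l, Real.exp (x k * x l) * v k * v l) := by
  have hexp (k l : n) : HasSum (fun m : ℕ => (x k * x l) ^ m / (m.factorial : ℝ) * v k * v l)
      (Real.exp (x k * x l) * v k * v l) := by
    have hseries := NormedSpace.expSeries_div_hasSum_exp (x k * x l)
    rw [← Real.exp_eq_exp_ℝ] at hseries
    exact (hseries.mul_right _).mul_right _
  have hsum := hasSum_sum (s := Finset.univ) fun k _ =>
    hasSum_sum (s := Finset.univ) fun l _ => hexp k l
  convert hsum using 2 with m
  rw [pow_two, Finset.sum_mul_sum]
  simp only [Finset.mul_sum]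
  exact Finset.sum_congr rfl fun k _ => Finset.sum_congr rfl fun l _ => by ring

lemma posSemidef_exp_mul {n : Type*} [Finite n] (x : n → ℝ) :
    (of fun k l => Real.exp (x k * x l)).PosSemidef :=
  have := Fintype.ofFinite n
  posSemidef_iff_isSymm_and_sum_nonneg.2 ⟨IsSymm.ext fun k l => by simp [mul_comm],
    fun v => (hasSum_quadratic_form_exp x v).nonneg fun m => by positivity⟩

-- If the form vanishes at `v`, then so does every moment of `v` at the nodes `x`.
lemma posDef_exp_mul {n : ℕ} {x : Fin n → ℝ} (hx : Function.Injective x) :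
    (of fun k l => Real.exp (x k * x l)).PosDef := by
  refine .of_dotProduct_mulVec_pos (posSemidef_exp_mul x).isHermitian fun v hv =>
    ((posSemidef_exp_mul x).dotProduct_mulVec_nonneg v).lt_of_ne' fun hzero => hv ?_
  rw [star_dotProduct_mulVec_eq_sum] at hzero
  have hmoments := (hasSum_zero_iff_of_nonneg fun m => by positivity).1
    (hzero ▸ hasSum_quadratic_form_exp x v)
  refine eq_zero_of_forall_pow_sum_mul_pow_eq_zero hx fun m => ?_
  simpa [Nat.factorial_ne_zero] using congrFun hmoments m

lemma gauss_apply (N : ℕ) (lam : ℝ) (k l : Fin (N + 1)) :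
    gauss N lam k l = lam ^ (((k : ℤ) - (l : ℤ)).natAbs ^ 2) := rfl

lemma isSymm_gauss (N : ℕ) (lam : ℝ) : (gauss N lam).IsSymm :=
  IsSymm.ext fun k l => by rw [gauss_apply, gauss_apply, ← Int.natAbs_neg, neg_sub]

@[simp] lemma gauss_apply_self (N : ℕ) (lam : ℝ) (k : Fin (N + 1)) : gauss N lam k k = 1 := by
  simp [gauss_apply]

lemma gauss_mul (N : ℕ) (lam mu : ℝ) : gauss N (lam * mu) = gauss N lam ⊙ gauss N mu := by
  ext k l
  simp [gauss_apply, mul_pow]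

lemma gauss_zero (N : ℕ) : gauss N 0 = 1 := by
  ext k l
  rcases eq_or_ne k l with rfl | hkl
  · simp
  · have hsub : (k : ℤ) - l ≠ 0 := sub_ne_zero.2 (mod_cast Fin.val_ne_of_ne hkl)
    rw [gauss_apply, one_apply_ne hkl, zero_pow (pow_ne_zero 2 (Int.natAbs_ne_zero.2 hsub))]

lemma continuous_gauss (N : ℕ) : Continuous (gauss N) := by
  unfold gauss
  fun_prop

-- Expand `(k - l) ^ 2` in the exponent.
lemma gauss_eq_mul (N : ℕ) {lam : ℝ} (h0 : 0 < lam) (h1 : lam ≤ 1) :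
    gauss N lam = (diagonal fun k : Fin (N + 1) => lam ^ ((k : ℕ) ^ 2))ᴴ *
      (of fun k l : Fin (N + 1) =>
        Real.exp (√(-2 * Real.log lam) * k * (√(-2 * Real.log lam) * l))) *
      diagonal fun k : Fin (N + 1) => lam ^ ((k : ℕ) ^ 2) := by
  have hlog : 0 ≤ -2 * Real.log lam := by linarith [Real.log_nonpos h0.le h1]
  ext k l
  have hexp : Real.exp (√(-2 * Real.log lam) * k * (√(-2 * Real.log lam) * l)) =
      lam ^ (-(2 * (k : ℤ) * l)) := by
    rw [mul_mul_mul_comm, Real.mul_self_sqrt hlog, ← Real.rpow_intCast, Real.rpow_def_of_pos h0]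
    push_cast
    ring_nf
  rw [diagonal_conjTranspose, mul_diagonal, diagonal_mul, gauss_apply, of_apply, hexp]
  simp only [Pi.star_apply, star_trivial, ← zpow_natCast, ← zpow_add₀ h0.ne']
  congr 1
  push_cast
  rw [sq_abs]
  ring

lemma posSemidef_gauss (N : ℕ) {lam : ℝ} (hlam : lam ∈ Set.Icc (0 : ℝ) 1) :
    (gauss N lam).PosSemidef := by
  rcases hlam.1.eq_or_lt with rfl | hpos
  · exact gauss_zero N ▸ .one
  · rw [gauss_eq_mul N hpos hlam.2]
    exact (posSemidef_exp_mul _).conjTranspose_mul_mul_same _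

lemma posDef_gauss (N : ℕ) {lam : ℝ} (hlam : lam ∈ Set.Ico (0 : ℝ) 1) : (gauss N lam).PosDef := by
  rcases hlam.1.eq_or_lt with rfl | hpos
  · exact gauss_zero N ▸ .one
  · have hsqrt : √(-2 * Real.log lam) ≠ 0 :=
      (Real.sqrt_pos.2 (by linarith [Real.log_neg hpos hlam.2])).ne'
    rw [gauss_eq_mul N hpos hlam.2.le]
    refine (posDef_exp_mul fun k l hkl => ?_).conjTranspose_mul_mul_same ?_
    · exact Fin.ext (Nat.cast_injective (mul_left_cancel₀ hsqrt hkl))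
    · refine mulVec_injective_of_isUnit ((isUnit_diagonal).2 ?_)
      exact Pi.isUnit_iff.2 fun k => (pow_ne_zero _ hpos.ne').isUnit

end Gauss

/-! ### Moving inside the region of compatible pairs -/

section Region

open Matrix

variable {N : ℕ} {α lam lam' t : ℝ}

lemma splits_zero_left (hlam : lam ∈ Set.Icc (0 : ℝ) 1) : Splits N 0 lam := by
  rw [Splits]
  convert hasSplitting_of_weights (posSemidef_gauss N hlam) (fun j : Fin (N + 1) => coin_nonneg N j)
    (sum_coin N) using 1
  ext j k
  simp [mixProb]

lemma splits_zero_right (hα : α ∈ Set.Icc (0 : ℝ) 1) : Splits N α 0 := by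
  have hdiag := hasSplitting_diagonal (mixProb_nonneg (N := N) hα)
  rwa [sum_mixProb, Pi.one_def, diagonal_one, ← gauss_zero] at hdiag

lemma Splits.add_remainder (h : Splits N α lam) (ht : 0 ≤ t)
    (hR : (gauss N lam' - t • gauss N lam).PosSemidef) : Splits N (t * α) lam' := by
  rw [Splits]
  convert (HasSplitting.smul h ht).add (hasSplitting_of_weights hR
    (fun j : Fin (N + 1) => coin_nonneg N j) (sum_coin N)) using 1
  · abel
  · ext j k
    simp only [mixProb, gauss_apply_self, Pi.add_apply, Pi.smul_apply, Matrix.sub_apply,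
      Matrix.smul_apply, smul_eq_mul]
    split_ifs <;> ring

-- The Schur product with the positive definite kernel of parameter `lam' / lam` leaves a multiple
-- of the identity to spare, which is given to the diagonal projections.
lemma Splits.exists_larger_weight (h : Splits N α lam) (hlam' : 0 ≤ lam') (hlt : lam' < lam) :
    ∃ t ∈ Set.Ioc (0 : ℝ) 1, Splits N ((1 - t) * α + t) lam' := by
  have hlam : 0 < lam := hlam'.trans_lt hlt
  set G := gauss N (lam' / lam) with hG
  have hGdef : G.PosDef := posDef_gauss N ⟨by positivity, (div_lt_one hlam).2 hlt⟩
  have hlim : Filter.Tendsto (fun t : ℝ => G - t • (1 : Matrix _ _ ℝ)) (𝓝[>] 0) (𝓝 G) := by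
    refine Filter.Tendsto.mono_left ?_ nhdsWithin_le_nhds
    exact Continuous.tendsto' (by fun_prop) _ _ (by simp)
  obtain ⟨t, hpsd, ht⟩ := ((hlim.eventually (eventually_posSemidef_of_posDef hGdef)).and
    (Ioc_mem_nhdsGT zero_lt_one)).exists
  have hG_sub : (G - t • (1 : Matrix _ _ ℝ)).PosSemidef :=
    hpsd ((isSymm_gauss N _).sub (isSymm_one.smul t))
  have hproj := hasSplitting_diagonal (p := fun j k : Fin (N + 1) => if k = j then t else 0)
    fun j k => ite_nonneg ht.1.le le_rfl
  refine ⟨t, ht, ?_⟩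
  rw [Splits]
  convert (HasSplitting.hadamard h hG_sub).add hproj using 1
  · ext k l
    rw [← mul_div_cancel₀ lam' hlam.ne', gauss_mul]
    rcases eq_or_ne k l with rfl | hkl
    · simp [hG]
    · simp [hG, hkl]
  · ext j k
    simp only [mixProb, hG, gauss_apply_self, Pi.add_apply, Matrix.sub_apply, Matrix.smul_apply,
      one_apply_eq, smul_eq_mul]
    split_ifs <;> ring

lemma Splits.exists_larger_right (h : Splits N α lam) (hlam : lam ∈ Set.Ico (0 : ℝ) 1)
    (ht : t ∈ Set.Ico (0 : ℝ) 1) : ∃ mu ∈ Set.Ioc lam 1, Splits N (t * α) mu := by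
  have hdef : (gauss N lam - t • gauss N lam).PosDef := by
    rw [← one_smul ℝ (gauss N lam), smul_smul, ← sub_smul, mul_one]
    exact (posDef_gauss N hlam).smul (sub_pos.2 ht.2)
  have hlim : Filter.Tendsto (fun mu => gauss N mu - t • gauss N lam) (𝓝[>] lam)
      (𝓝 (gauss N lam - t • gauss N lam)) :=
    ((continuous_gauss N).sub continuous_const).continuousAt.mono_left nhdsWithin_le_nhds
  obtain ⟨mu, hpsd, hmu⟩ := ((hlim.eventually (eventually_posSemidef_of_posDef hdef)).and
    (Ioc_mem_nhdsGT hlam.2)).exists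
  exact ⟨mu, hmu, h.add_remainder ht.1
    (hpsd ((isSymm_gauss N mu).sub ((isSymm_gauss N lam).smul t)))⟩

lemma isClosed_setOf_splits (N : ℕ) : IsClosed {p : ℝ × ℝ | Splits N p.1 p.2} := by
  have hcont : Continuous fun p : ℝ × ℝ => (gauss N p.2, mixProb N p.1) := by
    refine ((continuous_gauss N).comp continuous_snd).prodMk ?_
    refine continuous_pi fun j => continuous_pi fun k => ?_
    unfold mixProb
    split_ifs <;> fun_prop
  convert isCompact_setOf_hasSplitting_sum_eq_one.isClosed.preimage hcont using 1
  ext p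
  simp [Splits, sum_mixProb]

end Region

/-! ### The Hellinger bound -/

section Hellinger

open Matrix

lemma HasSplitting.apply_le_sum_sqrt {ι Ω : Type*} [Fintype Ω] {C : Matrix ι ι ℝ} {p : Ω → ι → ℝ}
    (h : HasSplitting C p) (k l : ι) : C k l ≤ ∑ j, √(p j k * p j l) := by
  obtain ⟨D, hD, rfl, hp⟩ := h
  rw [Matrix.sum_apply]
  refine Finset.sum_le_sum fun j _ => Real.le_sqrt_of_sq_le ?_
  simpa [← hp j] using sq_apply_le_of_posSemidef (hD j) k l

variable {N k : ℕ} {α : ℝ}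

lemma beta_eq (N : ℕ) (α : ℝ) :
    beta N 0 1 α = uN N 0 α + uN N 1 α + (1 - α) * (1 - coin N 0 - coin N 1) := by
  unfold beta uN
  ring

lemma coin_zero_add_coin_one_le (hN : 1 ≤ N) : coin N 0 + coin N 1 ≤ 1 := by
  rw [← sum_coin N, Fin.sum_univ_eq_sum_range (fun j => coin N j)]
  calc coin N 0 + coin N 1 = ∑ j ∈ Finset.range 2, coin N j := by
        rw [Finset.sum_range_succ, Finset.sum_range_one]
    _ ≤ _ := Finset.sum_le_sum_of_subset_of_nonneg
        (Finset.range_subset_range.2 (by lia)) fun j _ _ => coin_nonneg N j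

lemma coin_le_one (N k : ℕ) : coin N k ≤ 1 := by
  rw [coin, div_le_one (by positivity)]
  exact_mod_cast Nat.choose_le_two_pow N k

lemma coin_mul_one_sub_nonneg (hα : α ≤ 1) (N k : ℕ) : 0 ≤ coin N k * (1 - α) :=
  mul_nonneg (coin_nonneg N k) (sub_nonneg.2 hα)

lemma uN_sq (hα : α ∈ Set.Icc (0 : ℝ) 1) (N k : ℕ) :
    uN N k α ^ 2 = coin N k * (1 - α) * (α + coin N k * (1 - α)) :=
  have hq := coin_mul_one_sub_nonneg hα.2 N k
  Real.sq_sqrt (mul_nonneg hq (add_nonneg hα.1 hq))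

lemma uN_nonneg (N k : ℕ) (α : ℝ) : 0 ≤ uN N k α := Real.sqrt_nonneg _

lemma uN_eq_mul (hα : α ≤ 1) (N k : ℕ) :
    uN N k α = √(coin N k * (1 - α)) * √(α + coin N k * (1 - α)) :=
  Real.sqrt_mul (coin_mul_one_sub_nonneg hα N k) _

lemma uN_one (N k : ℕ) : uN N k 1 = 0 := by simp [uN]

lemma uN_zero (N k : ℕ) : uN N k 0 = coin N k := by
  simp [uN, Real.sqrt_mul_self (coin_nonneg N k)]

lemma sum_sqrt_mixProb_mul_mixProb (hα : α ≤ 1) {k l : Fin (N + 1)} (hkl : k ≠ l) :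
    ∑ j, √(mixProb N α j k * mixProb N α j l) =
      uN N k α + uN N l α + (1 - α) * (1 - coin N k - coin N l) := by
  have hterm (j : Fin (N + 1)) : √(mixProb N α j k * mixProb N α j l) = (1 - α) * coin N j +
      ((if j = k then uN N k α - coin N k * (1 - α) else 0) +
        (if j = l then uN N l α - coin N l * (1 - α) else 0)) := by
    rcases eq_or_ne j k with rfl | hjk
    · simp only [mixProb, uN, if_true, if_neg hkl, if_neg hkl.symm]
      ring_nf
    rcases eq_or_ne j l with rfl | hjl
    · simp only [mixProb, uN, if_true, if_neg hkl, if_neg hkl.symm]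
      ring_nf
    · have hq := mul_nonneg (sub_nonneg.2 hα) (coin_nonneg N j)
      simp only [mixProb, if_neg hjk, if_neg hjl, if_neg hjk.symm, if_neg hjl.symm, zero_add,
        add_zero, Real.sqrt_mul_self hq]
  simp only [hterm, Finset.sum_add_distrib, ← Finset.mul_sum, sum_coin, Finset.sum_ite_eq',
    Finset.mem_univ, if_true]
  ring

lemma Splits.le_beta {lam : ℝ} (h : Splits N α lam) (hN : 1 ≤ N) (hα : α ≤ 1) :
    lam ≤ beta N 0 1 α := by
  let k : Fin (N + 1) := ⟨0, by lia⟩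
  let l : Fin (N + 1) := ⟨1, by lia⟩
  have hkl : k ≠ l := by simp [k, l]
  calc lam = gauss N lam k l := by simp [gauss_apply, k, l]
    _ ≤ ∑ j, √(mixProb N α j k * mixProb N α j l) := HasSplitting.apply_le_sum_sqrt h k l
    _ = beta N 0 1 α := by rw [sum_sqrt_mixProb_mul_mixProb hα hkl, beta_eq]

lemma beta_eq_hellinger (hα : α ∈ Set.Icc (0 : ℝ) 1) : beta N 0 1 α = 1 -
    ((√(α + coin N 0 * (1 - α)) - √(coin N 0 * (1 - α))) ^ 2 +
      (√(α + coin N 1 * (1 - α)) - √(coin N 1 * (1 - α))) ^ 2) / 2 := by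
  have h0 := coin_mul_one_sub_nonneg hα.2 N 0
  have h1 := coin_mul_one_sub_nonneg hα.2 N 1
  rw [beta_eq, uN_eq_mul hα.2, uN_eq_mul hα.2]
  linear_combination (1 / 2) * (Real.sq_sqrt h0 + Real.sq_sqrt h1 +
    Real.sq_sqrt (add_nonneg hα.1 h0) + Real.sq_sqrt (add_nonneg hα.1 h1))

lemma sqrt_sub_sqrt_coin_lt (hk : k ≤ N) {a b : ℝ} (hab : a < b) (hb : b ≤ 1) :
    √(a + coin N k * (1 - a)) - √(coin N k * (1 - a)) <
      √(b + coin N k * (1 - b)) - √(coin N k * (1 - b)) := by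
  have hc := coin_pos hk
  have hle : √(a + coin N k * (1 - a)) ≤ √(b + coin N k * (1 - b)) := Real.sqrt_le_sqrt
    (by linarith [mul_nonneg (sub_nonneg.2 hab.le) (sub_nonneg.2 (coin_le_one N k))])
  have hlt : √(coin N k * (1 - b)) < √(coin N k * (1 - a)) :=
    Real.sqrt_lt_sqrt (coin_mul_one_sub_nonneg hb N k) (by gcongr)
  linarith

lemma strictAntiOn_beta (hN : 1 ≤ N) : StrictAntiOn (beta N 0 1) (Set.Icc 0 1) := by
  intro a ha b hb hab
  have hsq {k : ℕ} (hk : k ≤ N) : (√(a + coin N k * (1 - a)) - √(coin N k * (1 - a))) ^ 2 <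
      (√(b + coin N k * (1 - b)) - √(coin N k * (1 - b))) ^ 2 :=
    pow_lt_pow_left₀ (sqrt_sub_sqrt_coin_lt hk hab hb.2)
      (sub_nonneg.2 (Real.sqrt_le_sqrt (by linarith [ha.1]))) two_ne_zero
  rw [beta_eq_hellinger ha, beta_eq_hellinger hb]
  linarith [hsq (Nat.zero_le N), hsq hN]

lemma beta_zero (N : ℕ) : beta N 0 1 0 = 1 := by
  rw [beta_eq, uN_zero, uN_zero]
  ring

lemma beta_one (N : ℕ) : beta N 0 1 1 = 0 := by
  rw [beta_eq, uN_one, uN_one]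
  ring

lemma bijOn_beta (hN : 1 ≤ N) : Set.BijOn (beta N 0 1) (Set.Icc 0 1) (Set.Icc 0 1) := by
  have hanti := strictAntiOn_beta hN
  have hcont : Continuous (beta N 0 1) := by
    unfold beta
    fun_prop
  refine ⟨fun a ha => ⟨?_, ?_⟩, hanti.injOn, ?_⟩
  · exact beta_one N ▸ hanti.antitoneOn ha ⟨zero_le_one, le_rfl⟩ ha.2
  · exact beta_zero N ▸ hanti.antitoneOn ⟨le_rfl, zero_le_one⟩ ha ha.1
  · simpa only [Set.SurjOn, beta_zero, beta_one] using
      intermediate_value_Icc' (zero_le_one' ℝ) hcont.continuousOn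

lemma uN_add_uN_mem_Icc (hN : 1 ≤ N) (hα : α ∈ Set.Icc (0 : ℝ) 1) :
    uN N 0 α + uN N 1 α ∈ Set.Icc (0 : ℝ) 1 := by
  have hbeta := ((bijOn_beta hN).mapsTo hα).2
  have hrest : 0 ≤ (1 - α) * (1 - coin N 0 - coin N 1) :=
    mul_nonneg (sub_nonneg.2 hα.2) (by linarith [coin_zero_add_coin_one_le hN])
  rw [beta_eq] at hbeta
  exact ⟨add_nonneg (uN_nonneg _ _ _) (uN_nonneg _ _ _), by linarith⟩

end Hellinger

/-! ### The critical weight -/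

section UnitInv

variable {f : ℝ → ℝ} {a : ℝ}

lemma unitInv_mem (hf : Set.BijOn f (Set.Icc 0 1) (Set.Icc 0 1)) (ha : a ∈ Set.Icc (0 : ℝ) 1) :
    unitInv f a ∈ Set.Icc (0 : ℝ) 1 :=
  Function.invFunOn_mem (hf.surjOn ha)

lemma apply_unitInv (hf : Set.BijOn f (Set.Icc 0 1) (Set.Icc 0 1)) (ha : a ∈ Set.Icc (0 : ℝ) 1) :
    f (unitInv f a) = a :=
  Function.invFunOn_eq (hf.surjOn ha)

lemma bijOn_unitInv (hf : Set.BijOn f (Set.Icc 0 1) (Set.Icc 0 1)) :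
    Set.BijOn (unitInv f) (Set.Icc 0 1) (Set.Icc 0 1) :=
  hf.symm hf.invOn_invFunOn.symm

lemma unitInv_unitInv (hf : Set.BijOn f (Set.Icc 0 1) (Set.Icc 0 1)) (ha : a ∈ Set.Icc (0 : ℝ) 1) :
    unitInv (unitInv f) a = f a := by
  have hinv := bijOn_unitInv hf
  rw [← apply_unitInv hf (unitInv_mem hinv ha), apply_unitInv hinv ha]

end UnitInv

section Critical

variable {N : ℕ} {α lam : ℝ}

lemma isGreatest_alphaN (N : ℕ) (hlam : lam ∈ Set.Icc (0 : ℝ) 1) :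
    IsGreatest (compatWeights N lam) (alphaN N lam) := by
  have hcompact : IsCompact (compatWeights N lam) := by
    convert isCompact_Icc (a := (0 : ℝ)) (b := 1) |>.inter_right
      ((isClosed_setOf_splits N).preimage (Continuous.prodMk_left lam)) using 1
    ext α
    exact mem_compatWeights_iff
  exact hcompact.isGreatest_sSup
    ⟨0, mem_compatWeights_iff.2 ⟨⟨le_rfl, zero_le_one⟩, splits_zero_left hlam⟩⟩

lemma alphaN_mem_Icc (N : ℕ) (hlam : lam ∈ Set.Icc (0 : ℝ) 1) :
    alphaN N lam ∈ Set.Icc (0 : ℝ) 1 :=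
  (mem_compatWeights_iff.1 (isGreatest_alphaN N hlam).1).1

lemma splits_alphaN (N : ℕ) (hlam : lam ∈ Set.Icc (0 : ℝ) 1) : Splits N (alphaN N lam) lam :=
  (mem_compatWeights_iff.1 (isGreatest_alphaN N hlam).1).2

lemma Splits.le_alphaN (h : Splits N α lam) (hα : α ∈ Set.Icc (0 : ℝ) 1)
    (hlam : lam ∈ Set.Icc (0 : ℝ) 1) : α ≤ alphaN N lam :=
  (isGreatest_alphaN N hlam).2 (mem_compatWeights_iff.2 ⟨hα, h⟩)

lemma strictAntiOn_alphaN (hN : 1 ≤ N) : StrictAntiOn (alphaN N) (Set.Icc 0 1) := by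
  intro a ha b hb hab
  have hmem := alphaN_mem_Icc N hb
  have hne : alphaN N b ≠ 1 := fun hone => by
    have hle := (splits_alphaN N hb).le_beta hN hmem.2
    rw [hone, beta_one] at hle
    exact (ha.1.trans_lt hab).not_ge hle
  obtain ⟨t, ht, hs⟩ := (splits_alphaN N hb).exists_larger_weight ha.1 hab
  have hgain : 0 < t * (1 - alphaN N b) := mul_pos ht.1 (sub_pos.2 (hmem.2.lt_of_ne hne))
  have hroom : 0 ≤ (1 - t) * (1 - alphaN N b) :=
    mul_nonneg (sub_nonneg.2 ht.2) (sub_nonneg.2 hmem.2)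
  have hle := hs.le_alphaN ⟨by linarith [hmem.1], by linarith⟩ ha
  linarith

lemma surjOn_alphaN (hN : 1 ≤ N) : Set.SurjOn (alphaN N) (Set.Icc 0 1) (Set.Icc 0 1) := by
  intro α hα
  have hcompact : IsCompact {lam | lam ∈ Set.Icc (0 : ℝ) 1 ∧ Splits N α lam} :=
    isCompact_Icc.inter_right ((isClosed_setOf_splits N).preimage (Continuous.prodMk_right α))
  obtain ⟨m, ⟨hm, hsplits⟩, hmax⟩ := hcompact.exists_isGreatest
    ⟨0, ⟨le_rfl, zero_le_one⟩, splits_zero_right hα⟩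
  refine ⟨m, hm, ((hsplits.le_alphaN hα hm).antisymm ?_).symm⟩
  by_contra! hlt
  have hpos : 0 < alphaN N m := hα.1.trans_lt hlt
  have hm_lt : m < 1 :=
    calc m ≤ beta N 0 1 (alphaN N m) := (splits_alphaN N hm).le_beta hN (alphaN_mem_Icc N hm).2
      _ < beta N 0 1 0 :=
        strictAntiOn_beta hN ⟨le_rfl, zero_le_one⟩ (alphaN_mem_Icc N hm) hpos
      _ = 1 := beta_zero N
  obtain ⟨m', hm', hsplits'⟩ := (splits_alphaN N hm).exists_larger_right ⟨hm.1, hm_lt⟩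
    (t := α / alphaN N m) ⟨div_nonneg hα.1 hpos.le, (div_lt_one hpos).2 hlt⟩
  rw [div_mul_cancel₀ _ hpos.ne'] at hsplits'
  exact (hmax ⟨⟨hm.1.trans hm'.1.le, hm'.2⟩, hsplits'⟩).not_gt hm'.1

lemma bijOn_alphaN (hN : 1 ≤ N) : Set.BijOn (alphaN N) (Set.Icc 0 1) (Set.Icc 0 1) :=
  ⟨fun _ => alphaN_mem_Icc N, (strictAntiOn_alphaN hN).injOn, surjOn_alphaN hN⟩

lemma splits_unitInv_alphaN (hN : 1 ≤ N) (hα : α ∈ Set.Icc (0 : ℝ) 1) :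
    Splits N α (unitInv (alphaN N) α) := by
  simpa only [apply_unitInv (bijOn_alphaN hN) hα] using
    splits_alphaN N (unitInv_mem (bijOn_alphaN hN) hα)

lemma Splits.le_unitInv_alphaN (h : Splits N α lam) (hN : 1 ≤ N) (hα : α ∈ Set.Icc (0 : ℝ) 1)
    (hlam : lam ∈ Set.Icc (0 : ℝ) 1) : lam ≤ unitInv (alphaN N) α := by
  have hle := h.le_alphaN hα hlam
  rw [← apply_unitInv (bijOn_alphaN hN) hα] at hle
  exact ((strictAntiOn_alphaN hN).le_iff_ge (unitInv_mem (bijOn_alphaN hN) hα) hlam).1 hle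

end Critical

/-! ### Up to four levels -/

section FewLevels

open Matrix

lemma hasSplitting_of_diag_le {ι Ω : Type*} [LinearOrder ι] [Finite ι] [Fintype Ω]
    {C : Matrix ι ι ℝ} {p : Ω → ι → ℝ} {D : Ω → Matrix ι ι ℝ} (hD : ∀ j, (D j).PosSemidef)
    (hC : C.IsSymm) (hdiag : ∀ k, C k k = ∑ j, p j k) (hle : ∀ j k, D j k k ≤ p j k)
    (hoff : ∀ k l, k < l → ∑ j, D j k l = C k l) : HasSplitting C p := by
  refine ⟨fun j => D j + diagonal fun k => p j k - D j k k, fun j => ?_, ?_, fun j => ?_⟩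
  · exact (hD j).add (.diagonal fun k => sub_nonneg.2 (hle j k))
  · have hsymm (j : Ω) (k l : ι) : D j k l = D j l k := (hD j).isHermitian.apply l k
    ext k l
    rcases lt_trichotomy k l with hkl | rfl | hkl
    · simp [Matrix.sum_apply, diagonal_apply_ne _ hkl.ne, hoff k l hkl]
    · simp [Matrix.sum_apply, hdiag]
    · simp [Matrix.sum_apply, diagonal_apply_ne _ hkl.ne', ← hC.apply k l, ← hoff l k hkl,
        hsymm _ k l]
  · ext k
    simp

variable {α lam : ℝ}

lemma splits_of_diag_le {N : ℕ} {D : Fin (N + 1) → Matrix (Fin (N + 1)) (Fin (N + 1)) ℝ}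
    (hD : ∀ j, (D j).PosSemidef) (hle : ∀ j k, D j k k ≤ mixProb N α j k)
    (hoff : ∀ k l, k < l → ∑ j, D j k l = gauss N lam k l) : Splits N α lam :=
  hasSplitting_of_diag_le hD (isSymm_gauss N lam)
    (fun k => by rw [gauss_apply_self, ← Finset.sum_apply, sum_mixProb, Pi.one_apply]) hle hoff

lemma splits_of_vectors {N : ℕ} {κ : Type*} [Fintype κ]
    (v : Fin (N + 1) → κ → Fin (N + 1) → ℝ) (hle : ∀ j k, ∑ i, v j i k ^ 2 ≤ mixProb N α j k)
    (hoff : ∀ k l, k < l → ∑ j, ∑ i, v j i k * v j i l = gauss N lam k l) : Splits N α lam :=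
  splits_of_diag_le (D := fun j => ∑ i, vecMulVec (v j i) (star (v j i)))
    (fun j => posSemidef_sum _ fun i _ => posSemidef_vecMulVec_self_star _)
    (fun j k => by simpa [Matrix.sum_apply, vecMulVec_apply, ← sq] using hle j k)
    fun k l hkl => by simpa [Matrix.sum_apply, vecMulVec_apply] using hoff k l hkl

lemma splits_one_level (hα : α ∈ Set.Icc (0 : ℝ) 1) : Splits 1 α (uN 1 0 α + uN 1 1 α) := by
  have hp := mixProb_nonneg (N := 1) hα
  refine splits_of_vectors (κ := Unit) (fun j _ k => √(mixProb 1 α j k))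
    (fun j k => by simp [Real.sq_sqrt (hp j k)]) fun k l hkl => ?_
  obtain ⟨rfl, rfl⟩ : k = 0 ∧ l = 1 := by decide +revert
  simp only [Finset.univ_unique, Finset.sum_singleton, ← Real.sqrt_mul (hp _ _),
    gauss_apply, uN]
  simp [mixProb]
  ring_nf

lemma splits_two_levels_of_coefficients {s₀ t₀ s₁ t₁ a b : ℝ} (hs₀ : s₀ ^ 2 = α + 1 / 4 * (1 - α))
    (ht₀ : t₀ ^ 2 = 1 / 4 * (1 - α)) (hs₁ : s₁ ^ 2 = α + 1 / 2 * (1 - α))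
    (ht₁ : t₁ ^ 2 = 1 / 2 * (1 - α))
    (ha : a ^ 2 ≤ 1) (hb : b ^ 2 ≤ 1) (h1 : t₀ * s₀ * a + t₁ * s₁ + t₀ ^ 2 * a * b = lam)
    (h2 : 2 * (t₀ * s₀) * b + t₁ ^ 2 = lam ^ 4) : Splits 2 α lam := by
  have hta : (t₀ * a) ^ 2 ≤ t₀ ^ 2 := by
    rw [mul_pow]; exact mul_le_of_le_one_right (sq_nonneg _) ha
  have htb : (t₀ * b) ^ 2 ≤ t₀ ^ 2 := by
    rw [mul_pow]; exact mul_le_of_le_one_right (sq_nonneg _) hb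
  refine splits_of_vectors (κ := Unit) (fun j _ => ![![s₀, t₀ * a, t₀ * b], ![t₁, s₁, t₁],
    ![t₀ * b, t₀ * a, s₀]] j) (fun j k => ?_) fun k l hkl => ?_
  · fin_cases j <;> fin_cases k <;> simp [mixProb, coin, Nat.choose] <;> linarith
  · fin_cases k <;> fin_cases l <;> simp [Fin.sum_univ_three, gauss_apply] at hkl ⊢ <;> linarith

lemma exists_two_level_coefficients {q u lam : ℝ} (hq : 0 < q) (hqu : q < u)
    (hlam : 0 ≤ lam) (hlam' : lam ≤ 2 * u) :
    ∃ a b, a ^ 2 ≤ 1 ∧ b ^ 2 ≤ 1 ∧ a * (u + q * b) = u - q ^ 2 / u ∧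
      2 * u * b = lam - 2 * q := by
  have hu := hq.trans hqu
  have hb : -(q / u) ≤ (lam - 2 * q) / (2 * u) := by
    rw [neg_le_iff_add_nonneg, show (lam - 2 * q) / (2 * u) + q / u = lam / (2 * u) by
      field_simp; ring]
    positivity
  have hqu1 : q / u < 1 := (div_lt_one hu).2 hqu
  have hle : u - q ^ 2 / u ≤ u + q * ((lam - 2 * q) / (2 * u)) := by
    have := mul_le_mul_of_nonneg_left hb hq.le
    rw [show q ^ 2 / u = q * (q / u) by ring]
    linarith
  have hpos : 0 < u - q ^ 2 / u := by
    rw [sub_pos, div_lt_iff₀ hu, ← sq]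
    gcongr
  have hden := hpos.trans_le hle
  refine ⟨(u - q ^ 2 / u) / (u + q * ((lam - 2 * q) / (2 * u))), (lam - 2 * q) / (2 * u),
    pow_le_one₀ (div_nonneg hpos.le hden.le) ((div_le_one hden).2 hle), ?_,
    div_mul_cancel₀ _ hden.ne', by field_simp⟩
  rw [sq_le_one_iff_abs_le_one, abs_le, div_le_one (by positivity)]
  constructor <;> linarith

lemma two_level_bounds {q u₀ u₁ : ℝ} (hq : 0 < q) (hq' : 4 * q < 1) (hu₀ : 0 ≤ u₀)
    (h₀ : u₀ ^ 2 = q * (1 - 3 * q)) (h₁ : u₁ ^ 2 = 2 * q * (1 - 2 * q)) :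
    q < u₀ ∧ u₀ ≤ 3 / 10 ∧ u₁ ≤ 1 / 2 ∧ u₁ ≤ 2 * u₀ :=
  ⟨lt_of_pow_lt_pow_left₀ 2 hu₀ (by nlinarith),
    le_of_sq_le_sq (by nlinarith [sq_nonneg (1 - 6 * q)]) (by norm_num),
    le_of_sq_le_sq (by nlinarith [sq_nonneg (1 - 4 * q)]) (by norm_num),
    le_of_sq_le_sq (by nlinarith) (by positivity)⟩

lemma splits_two_levels (h0 : 0 < α) (h1 : α < 1) :
    Splits 2 α (uN 2 0 α + uN 2 1 α - (1 - α) ^ 2 / (16 * uN 2 0 α)) ∧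
      uN 2 0 α + uN 2 1 α - (1 - α) ^ 2 / (16 * uN 2 0 α) ∈ Set.Icc (0 : ℝ) 1 := by
  have hα : α ∈ Set.Icc (0 : ℝ) 1 := ⟨h0.le, h1.le⟩
  have hu0 := uN_sq hα 2 0
  have hu1 := uN_sq hα 2 1
  have hu0e := uN_eq_mul hα.2 2 0
  have hu1e := uN_eq_mul hα.2 2 1
  have hsum := (uN_add_uN_mem_Icc (by norm_num : 1 ≤ 2) hα).2
  have hn0 := uN_nonneg 2 0 α
  have hn1 := uN_nonneg 2 1 α
  rw [show coin 2 0 = 1 / 4 by norm_num [coin]] at hu0 hu0e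
  rw [show coin 2 1 = 1 / 2 by norm_num [coin]] at hu1 hu1e
  generalize uN 2 0 α = u₀ at *
  generalize uN 2 1 α = u₁ at *
  obtain ⟨q, rfl⟩ : ∃ q, α = 1 - 4 * q := ⟨(1 - α) / 4, by ring⟩
  have hq : 0 < q := by linarith
  obtain ⟨hqu, hu0b, hu1b, hu12⟩ := two_level_bounds hq (by linarith) hn0
    (by rw [hu0]; ring) (by rw [hu1]; ring)
  have hu0pos := hq.trans hqu
  have hdiv : q ^ 2 / u₀ < u₀ := by rw [div_lt_iff₀ hu0pos, ← sq]; gcongr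
  have hdiv0 : 0 ≤ q ^ 2 / u₀ := by positivity
  rw [show (1 - (1 - 4 * q)) ^ 2 / (16 * u₀) = q ^ 2 / u₀ by field_simp; ring]
  set lam := u₀ + u₁ - q ^ 2 / u₀
  have hlam0 : 0 ≤ lam := by linarith
  have hlam4 : lam ^ 4 ≤ 2 * u₀ := by
    calc lam ^ 4 = lam ^ 3 * lam := by ring
      _ ≤ (8 / 10) ^ 3 * (3 * u₀) := by gcongr <;> linarith
      _ ≤ 2 * u₀ := by linarith
  obtain ⟨a, b, ha, hb, hab, hb'⟩ :=
    exists_two_level_coefficients hq hqu (pow_nonneg hlam0 4) hlam4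
  refine ⟨splits_two_levels_of_coefficients (Real.sq_sqrt ?_) (Real.sq_sqrt ?_) (Real.sq_sqrt ?_)
    (Real.sq_sqrt ?_) ha hb ?_ ?_, hlam0, by linarith⟩
  rotate_left 4
  · rw [← hu0e, ← hu1e, Real.sq_sqrt (by linarith)]
    linear_combination hab
  · rw [← hu0e, Real.sq_sqrt (by linarith)]
    linear_combination hb'
  all_goals linarith

lemma splits_three_levels_of_coefficients {s₀ t₀ s₁ t₁ a b d : ℝ}
    (hs₀ : s₀ ^ 2 = α + 1 / 8 * (1 - α)) (ht₀ : t₀ ^ 2 = 1 / 8 * (1 - α))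
    (hs₁ : s₁ ^ 2 = α + 3 / 8 * (1 - α)) (ht₁ : t₁ ^ 2 = 3 / 8 * (1 - α))
    (hab : a ^ 2 + b ^ 2 ≤ t₁ ^ 2) (hd : d ^ 2 ≤ t₀ ^ 2)
    (h01 : t₀ * s₀ + t₁ * s₁ = lam) (h12 : 2 * (s₁ * a) = lam)
    (h02 : t₁ * a + s₁ * b + t₀ * d = lam ^ 4) (h03 : 2 * (s₀ * d) + 2 * (t₁ * b) = lam ^ 9) :
    Splits 3 α lam := by
  have ht₀' := sq_nonneg t₀
  -- The second vectors of the two middle outcomes cancel the product `a * b` of the first ones.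
  refine splits_of_vectors (fun j : Fin 4 => ![![![s₀, t₀, 0, d], 0],
    ![![t₁, s₁, a, b], ![0, 0, b, -a]], ![![b, a, s₁, t₁], ![-a, b, 0, 0]],
    ![![d, 0, t₀, s₀], 0]] j) (fun j k => ?_) fun k l hkl => ?_
  · fin_cases j <;> fin_cases k <;> simp [mixProb, coin, Nat.choose] <;> linarith
  · fin_cases k <;> fin_cases l <;> simp [Fin.sum_univ_four, gauss_apply] at hkl ⊢ <;> linarith

lemma splits_three_levels_of_ratios {s₀ t₀ s₁ t₁ m y : ℝ}
    (hs₀ : s₀ ^ 2 = α + 1 / 8 * (1 - α)) (ht₀ : t₀ ^ 2 = 1 / 8 * (1 - α))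
    (hs₁ : s₁ ^ 2 = α + 3 / 8 * (1 - α)) (ht₁ : t₁ ^ 2 = 3 / 8 * (1 - α))
    (hs₀' : 0 < s₀) (ht₀' : 0 < t₀) (hs₁' : 0 < s₁) (hlam : t₀ * s₀ + t₁ * s₁ = lam)
    (hm : 2 * (t₁ * s₁) * m = lam)
    (hy : y * (1 - t₀ / s₀ * (t₁ / s₁)) = m * (2 * lam ^ 3 - t₁ / s₁ - t₀ / s₀ * lam ^ 8))
    (hmy : m ^ 2 + y ^ 2 ≤ 1) (hd : |lam / (2 * (t₀ * s₀)) * lam ^ 8 - 3 * (t₀ / s₀) * y| ≤ 1) :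
    Splits 3 α lam := by
  have ht₁₀ : t₁ ^ 2 = 3 * t₀ ^ 2 := by rw [ht₁, ht₀]; ring
  refine splits_three_levels_of_coefficients hs₀ ht₀ hs₁ ht₁ (a := m * t₁) (b := y * t₁)
    (d := (lam / (2 * (t₀ * s₀)) * lam ^ 8 - 3 * (t₀ / s₀) * y) * t₀) ?_ ?_ hlam ?_ ?_ ?_
  · rw [mul_pow, mul_pow, ← add_mul]
    exact mul_le_of_le_one_left (sq_nonneg _) hmy
  · rw [mul_pow]
    exact mul_le_of_le_one_left (sq_nonneg _) ((sq_le_one_iff_abs_le_one _).2 hd)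
  · rw [← hm]; ring
  · have hma : t₁ * (m * t₁) = t₁ / s₁ * lam / 2 := by
      rw [← hm]; field_simp
    have hld : lam / (2 * (t₀ * s₀)) * lam ^ 8 * t₀ * t₀ = t₀ / s₀ * lam ^ 9 / 2 := by
      field_simp
    have hyd : 3 * (t₀ / s₀) * y * t₀ * t₀ = t₀ / s₀ * (t₁ / s₁) * y * (t₁ * s₁) := by
      field_simp
      linear_combination (-y) * ht₁₀
    linear_combination hma + hld - hyd + t₁ * s₁ * hy +
      (lam ^ 3 - (t₁ / s₁) / 2 - t₀ / s₀ * lam ^ 8 / 2) * hm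
  · field_simp
    linear_combination (2 * y) * ht₁₀

lemma three_level_bounds {e u₀ u₁ : ℝ} (he : 0 < e) (he' : e ≤ 7 / 10) (hu₀ : 0 ≤ u₀)
    (hu₁ : 0 ≤ u₁) (h₀ : u₀ ^ 2 = e / 8 * (1 - 7 * e / 8))
    (h₁ : u₁ ^ 2 = 3 * e / 8 * (1 - 5 * e / 8)) :
    u₀ + u₁ ≤ 6 / 10 ∧ u₀ ≤ 5776 / 10000 * u₁ ∧ u₁ ≤ 21 / 10 * u₀ := by
  have hu₀' : u₀ ≤ 19 / 100 :=
    le_of_sq_le_sq (by nlinarith only [h₀, sq_nonneg (7 * e - 4)]) (by norm_num)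
  have hu₁' : u₁ ≤ 39 / 100 :=
    le_of_sq_le_sq (by nlinarith only [h₁, sq_nonneg (5 * e - 4)]) (by norm_num)
  exact ⟨by linarith, le_of_sq_le_sq (by nlinarith only [h₀, h₁, he]) (by positivity),
    le_of_sq_le_sq (by nlinarith only [h₀, h₁, he, he']) (by positivity)⟩

lemma three_level_bounds_of_half_le {e u₀ u₁ : ℝ} (he : 1 / 2 ≤ e) (he' : e ≤ 7 / 10)
    (hu₀ : 0 ≤ u₀) (hu₁ : 0 ≤ u₁) (h₀ : u₀ ^ 2 = e / 8 * (1 - 7 * e / 8))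
    (h₁ : u₁ ^ 2 = 3 * e / 8 * (1 - 5 * e / 8)) :
    u₀ ≤ 5224 / 10000 * u₁ ∧ 45 / 100 ≤ u₀ + u₁ := by
  have hu₀' : 1 / 10 ≤ u₀ := le_of_sq_le_sq (by nlinarith only [h₀, he, he']) hu₀
  have hu₁' : 35 / 100 ≤ u₁ := le_of_sq_le_sq (by nlinarith only [h₁, he, he']) hu₁
  exact ⟨le_of_sq_le_sq (by nlinarith only [h₀, h₁, he]) (by positivity), by linarith⟩

lemma div_le_of_sq_le {s t r : ℝ} (hs : 0 < s) (hr : 0 ≤ r) (h : t ^ 2 ≤ r ^ 2 * s ^ 2) :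
    t / s ≤ r :=
  (div_le_iff₀ hs).2 (le_of_sq_le_sq (by rwa [mul_pow]) (by positivity))

lemma three_level_numerator_le {m lam τ σ : ℝ} (hm : 0 ≤ m) (hm' : m ≤ 7888 / 10000)
    (hlam : 0 ≤ lam) (hlam' : lam ≤ 6 / 10) (hτ : 0 ≤ τ) (hτ' : τ ≤ 4753 / 10000) (hσ : 0 ≤ σ)
    (hσ' : σ ≤ 6832 / 10000)
    (h : τ ≤ 3334 / 10000 ∧ σ ≤ 5223 / 10000 ∨ m ≤ 7612 / 10000 ∧ 45 / 100 ≤ lam) :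
    |m * (2 * lam ^ 3 - σ - τ * lam ^ 8)| ≤ 6 / 10 * (1 - τ * σ) := by
  have hlam3 : 0 ≤ lam ^ 3 := by positivity
  have hτlam : τ * lam ^ 8 ≤ 4753 / 10000 * (6 / 10) ^ 8 := by gcongr
  have hτlam0 : 0 ≤ τ * lam ^ 8 := by positivity
  rw [abs_le, neg_le, ← mul_neg]
  constructor
  · obtain ⟨hτ₁, hσ₁⟩ | ⟨hm₁, hlam₁⟩ := h
    · calc m * -(2 * lam ^ 3 - σ - τ * lam ^ 8)
          ≤ m * (5223 / 10000 + 4753 / 10000 * (6 / 10) ^ 8) := by gcongr; linarith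
        _ ≤ 7888 / 10000 * (5223 / 10000 + 4753 / 10000 * (6 / 10) ^ 8) := by gcongr
        _ ≤ 6 / 10 * (1 - 3334 / 10000 * (5223 / 10000)) := by norm_num
        _ ≤ 6 / 10 * (1 - τ * σ) := by gcongr
    · have hlam₃ : (45 / 100) ^ 3 ≤ lam ^ 3 := by gcongr
      calc m * -(2 * lam ^ 3 - σ - τ * lam ^ 8)
          ≤ m * (6832 / 10000 + 4753 / 10000 * (6 / 10) ^ 8 - 2 * (45 / 100) ^ 3) := by
            gcongr; linarith
        _ ≤ 7612 / 10000 *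
            (6832 / 10000 + 4753 / 10000 * (6 / 10) ^ 8 - 2 * (45 / 100) ^ 3) := by
            gcongr
        _ ≤ 6 / 10 * (1 - 4753 / 10000 * (6832 / 10000)) := by norm_num
        _ ≤ 6 / 10 * (1 - τ * σ) := by gcongr
  · have hlam₃ : lam ^ 3 ≤ (6 / 10) ^ 3 := by gcongr
    calc m * (2 * lam ^ 3 - σ - τ * lam ^ 8) ≤ m * (2 * (6 / 10) ^ 3) := by gcongr; linarith
      _ ≤ 7888 / 10000 * (2 * (6 / 10) ^ 3) := by gcongr
      _ ≤ 6 / 10 * (1 - 4753 / 10000 * (6832 / 10000)) := by norm_num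
      _ ≤ 6 / 10 * (1 - τ * σ) := by gcongr

lemma exists_three_level_coefficients {u₀ u₁ lam τ σ : ℝ} (hu₀ : 0 < u₀) (hu₁ : 0 < u₁)
    (hlam : u₀ + u₁ = lam) (hlam' : lam ≤ 6 / 10) (hu₀₁ : u₀ ≤ 5776 / 10000 * u₁)
    (hu₁₀ : u₁ ≤ 21 / 10 * u₀) (hτ : 0 ≤ τ) (hτ' : τ ≤ 4753 / 10000) (hσ : 0 ≤ σ)
    (hσ' : σ ≤ 6832 / 10000)
    (h : τ ≤ 3334 / 10000 ∧ σ ≤ 5223 / 10000 ∨ u₀ ≤ 5224 / 10000 * u₁ ∧ 45 / 100 ≤ lam) :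
    ∃ m y, 2 * u₁ * m = lam ∧ y * (1 - τ * σ) = m * (2 * lam ^ 3 - σ - τ * lam ^ 8) ∧
      m ^ 2 + y ^ 2 ≤ 1 ∧ |lam / (2 * u₀) * lam ^ 8 - 3 * τ * y| ≤ 1 := by
  have hlam0 : 0 < lam := by linarith
  have hm_le {r : ℝ} (hr : u₀ ≤ r * u₁) : lam / (2 * u₁) ≤ (1 + r) / 2 := by
    rw [div_le_iff₀ (by positivity)]; linarith
  have hm0 : 0 ≤ lam / (2 * u₁) := by positivity
  have hm1 : lam / (2 * u₁) ≤ 7888 / 10000 := (hm_le hu₀₁).trans_eq (by norm_num)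
  have hm_eq : 2 * u₁ * (lam / (2 * u₁)) = lam := by field_simp
  have hm_or : τ ≤ 3334 / 10000 ∧ σ ≤ 5223 / 10000 ∨
      lam / (2 * u₁) ≤ 7612 / 10000 ∧ 45 / 100 ≤ lam :=
    h.imp_right fun hu => ⟨(hm_le hu.1).trans_eq (by norm_num), hu.2⟩
  generalize lam / (2 * u₁) = m at *
  have hτσ : τ * σ ≤ 4753 / 10000 * (6832 / 10000) := by gcongr
  have hden : 0 < 1 - τ * σ := by linarith
  have hy : |m * (2 * lam ^ 3 - σ - τ * lam ^ 8) / (1 - τ * σ)| ≤ 6 / 10 := by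
    rw [abs_div, abs_of_pos hden, div_le_iff₀ hden]
    exact three_level_numerator_le hm0 hm1 hlam0.le hlam' hτ hτ' hσ hσ' hm_or
  refine ⟨m, _, hm_eq, div_mul_cancel₀ _ hden.ne', ?_, ?_⟩
  · calc _ ≤ (7888 / 10000) ^ 2 + (6 / 10) ^ 2 := by
          rw [← sq_abs (_ / _)]; gcongr
      _ ≤ (1 : ℝ) := by norm_num
  · have hlu : lam / (2 * u₀) ≤ 155 / 100 := by
      rw [div_le_iff₀ (by positivity)]; linarith
    refine (abs_sub _ _).trans ?_
    rw [abs_mul (3 * τ), abs_of_nonneg (by positivity), abs_of_nonneg (by positivity : 0 ≤ 3 * τ)]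
    calc _ ≤ 155 / 100 * (6 / 10) ^ 8 + 3 * (4753 / 10000) * (6 / 10) := by gcongr
      _ ≤ (1 : ℝ) := by norm_num

lemma splits_three_levels_of_le (h0 : 3 / 10 ≤ α) (h1 : α < 1) :
    Splits 3 α (uN 3 0 α + uN 3 1 α) := by
  rw [uN_eq_mul h1.le, uN_eq_mul h1.le, show coin 3 0 = 1 / 8 by norm_num [coin],
    show coin 3 1 = 3 / 8 by norm_num [coin]]
  obtain ⟨e, rfl⟩ : ∃ e, α = 1 - e := ⟨1 - α, by ring⟩
  have hs₀ : √(1 - e + 1 / 8 * (1 - (1 - e))) ^ 2 = 1 - e + 1 / 8 * (1 - (1 - e)) :=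
    Real.sq_sqrt (by linarith)
  have ht₀ : √(1 / 8 * (1 - (1 - e))) ^ 2 = 1 / 8 * (1 - (1 - e)) := Real.sq_sqrt (by linarith)
  have hs₁ : √(1 - e + 3 / 8 * (1 - (1 - e))) ^ 2 = 1 - e + 3 / 8 * (1 - (1 - e)) :=
    Real.sq_sqrt (by linarith)
  have ht₁ : √(3 / 8 * (1 - (1 - e))) ^ 2 = 3 / 8 * (1 - (1 - e)) := Real.sq_sqrt (by linarith)
  have hs₀' : 0 < √(1 - e + 1 / 8 * (1 - (1 - e))) := Real.sqrt_pos.2 (by linarith)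
  have ht₀' : 0 < √(1 / 8 * (1 - (1 - e))) := Real.sqrt_pos.2 (by linarith)
  have hs₁' : 0 < √(1 - e + 3 / 8 * (1 - (1 - e))) := Real.sqrt_pos.2 (by linarith)
  have ht₁' : 0 < √(3 / 8 * (1 - (1 - e))) := Real.sqrt_pos.2 (by linarith)
  generalize √(1 - e + 1 / 8 * (1 - (1 - e))) = s₀ at *
  generalize √(1 / 8 * (1 - (1 - e))) = t₀ at *
  generalize √(1 - e + 3 / 8 * (1 - (1 - e))) = s₁ at *
  generalize √(3 / 8 * (1 - (1 - e))) = t₁ at *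
  have hu₀ : (t₀ * s₀) ^ 2 = e / 8 * (1 - 7 * e / 8) := by rw [mul_pow, hs₀, ht₀]; ring
  have hu₁ : (t₁ * s₁) ^ 2 = 3 * e / 8 * (1 - 5 * e / 8) := by rw [mul_pow, hs₁, ht₁]; ring
  obtain ⟨hlam, hu₀₁, hu₁₀⟩ := three_level_bounds (by linarith) (by linarith)
    (by positivity) (by positivity) hu₀ hu₁
  obtain ⟨m, y, hm, hy, hmy, hd⟩ := exists_three_level_coefficients (mul_pos ht₀' hs₀')
    (mul_pos ht₁' hs₁') rfl hlam hu₀₁ hu₁₀ (τ := t₀ / s₀) (σ := t₁ / s₁) (by positivity)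
    (div_le_of_sq_le hs₀' (by norm_num) (by linarith)) (by positivity)
    (div_le_of_sq_le hs₁' (by norm_num) (by linarith))
    ((le_total e (1 / 2)).imp
      (fun he => ⟨div_le_of_sq_le hs₀' (by norm_num) (by linarith),
        div_le_of_sq_le hs₁' (by norm_num) (by linarith)⟩)
      fun he => three_level_bounds_of_half_le he (by linarith) (by positivity) (by positivity)
        hu₀ hu₁)
  exact splits_three_levels_of_ratios hs₀ ht₀ hs₁ ht₁ hs₀' ht₀' hs₁' rfl hm hy hmy hd

lemma uN_three_add_uN_le (h0 : 0 ≤ α) (h1 : α ≤ 3 / 10) :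
    uN 3 0 α + uN 3 1 α ≤ uN 3 0 (3 / 10) + uN 3 1 (3 / 10) := by
  have hx := uN_sq ⟨h0, by linarith⟩ 3 0
  have hy := uN_sq ⟨h0, by linarith⟩ 3 1
  have hu := uN_sq (α := 3 / 10) ⟨by norm_num, by norm_num⟩ 3 0
  have hv := uN_sq (α := 3 / 10) ⟨by norm_num, by norm_num⟩ 3 1
  have hu0 := uN_nonneg 3 0 (3 / 10)
  have hv0 := uN_nonneg 3 1 (3 / 10)
  rw [show coin 3 0 = 1 / 8 by norm_num [coin]] at hx hu
  rw [show coin 3 1 = 3 / 8 by norm_num [coin]] at hy hv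
  generalize uN 3 0 α = x at *
  generalize uN 3 1 α = y at *
  generalize uN 3 0 (3 / 10) = u at *
  generalize uN 3 1 (3 / 10) = v at *
  replace hu0 : 0 < u := hu0.lt_of_ne' fun h => by norm_num [h] at hu
  replace hv0 : 0 < v := hv0.lt_of_ne' fun h => by norm_num [h] at hv
  have huv : 5 / 3 * u ≤ v := le_of_sq_le_sq (by rw [mul_pow, hu, hv]; norm_num) hv0.le
  have hδ : 0 ≤ 3 / 10 - α := by linarith
  have hxu : x - u ≤ -(9 / 640 * (3 / 10 - α)) / u := by
    rw [le_div_iff₀ hu0]; nlinarith only [sq_nonneg (x - u), hx, hu, hδ]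
  have hyv : y - v ≤ 3 / 128 * (3 / 10 - α) / v := by
    rw [le_div_iff₀ hv0]; nlinarith only [sq_nonneg (y - v), hy, hv, hδ]
  have hcompare : 3 / 128 * (3 / 10 - α) / v ≤ 9 / 640 * (3 / 10 - α) / u := by
    rw [div_le_div_iff₀ hv0 hu0]; nlinarith only [huv, hδ]
  rw [neg_div] at hxu
  linarith

lemma Splits.mono {N : ℕ} (h : Splits N α lam) (hN : 1 ≤ N) (hα : α ≤ 1) (hlam : lam ≤ 1)
    {α' lam' : ℝ} (hα' : 0 ≤ α') (hle : α' ≤ α) (hlam' : 0 ≤ lam') (hle' : lam' ≤ lam) :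
    Splits N α' lam' := by
  have hmem : lam' ∈ Set.Icc (0 : ℝ) 1 := ⟨hlam', hle'.trans hlam⟩
  have hαle : α' ≤ alphaN N lam' :=
    calc α' ≤ alphaN N lam :=
          hle.trans (h.le_alphaN ⟨hα'.trans hle, hα⟩ ⟨hlam'.trans hle', hlam⟩)
      _ ≤ alphaN N lam' :=
          (strictAntiOn_alphaN hN).antitoneOn hmem ⟨hlam'.trans hle', hlam⟩ hle'
  have ht : α' / alphaN N lam' ≤ 1 := div_le_one_of_le₀ hαle (hα'.trans hαle)
  have hscale := (splits_alphaN N hmem).add_remainder (lam' := lam')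
    (div_nonneg hα' (hα'.trans hαle)) (by
      rw [show gauss N lam' - (α' / alphaN N lam') • gauss N lam' =
        (1 - α' / alphaN N lam') • gauss N lam' by rw [sub_smul, one_smul]]
      exact (posSemidef_gauss N hmem).smul (sub_nonneg.2 ht))
  rwa [div_mul_cancel_of_imp fun h0 => (hαle.trans_eq h0).antisymm hα'] at hscale

lemma splits_one_uN_add_uN (N : ℕ) : Splits N 1 (uN N 0 1 + uN N 1 1) := by
  rw [uN_one, uN_one, add_zero]
  exact splits_zero_right ⟨zero_le_one, le_rfl⟩

lemma splits_three_levels (hα : α ∈ Set.Icc (0 : ℝ) 1) : Splits 3 α (uN 3 0 α + uN 3 1 α) := by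
  obtain rfl | h1 := hα.2.eq_or_lt
  · exact splits_one_uN_add_uN 3
  obtain h | h := le_total (3 / 10) α
  · exact splits_three_levels_of_le h h1
  · exact (splits_three_levels_of_le le_rfl (by norm_num)).mono (by norm_num) (by norm_num)
      (uN_add_uN_mem_Icc (by norm_num) ⟨by norm_num, by norm_num⟩).2 hα.1 h
      (uN_add_uN_mem_Icc (by norm_num) hα).1 (uN_three_add_uN_le hα.1 h)

end FewLevels

/-! ### At least four levels: the construction -/

section ManyLevels

open Matrix

lemma posSemidef_diagonal_add_of_sq_le_mul {n : Type*} [Fintype n] [DecidableEq n]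
    {T : Matrix n n ℝ} {d : n → ℝ} {w : n → n → ℝ} (hT : T.IsSymm) (hw : ∀ k l, 0 ≤ w k l)
    (hTw : ∀ k l, T k l ^ 2 ≤ w k l * w l k) (hd : ∀ k, ∑ l, w k l ≤ d k) :
    (diagonal d + T).PosSemidef := by
  refine posSemidef_iff_isSymm_and_sum_nonneg.2 ⟨(isSymm_diagonal d).add hT, fun x => ?_⟩
  have hterm (k l : n) : 0 ≤ w k l * x k ^ 2 + w l k * x l ^ 2 + 2 * (T k l * x k * x l) := by
    have hamgm := two_mul_le_add_of_sq_le_mul (r := |T k l * x k * x l|)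
      (mul_nonneg (hw k l) (sq_nonneg (x k))) (mul_nonneg (hw l k) (sq_nonneg (x l))) (by
        rw [sq_abs]
        calc (T k l * x k * x l) ^ 2 = T k l ^ 2 * (x k ^ 2 * x l ^ 2) := by ring
          _ ≤ w k l * w l k * (x k ^ 2 * x l ^ 2) := by gcongr; exact hTw k l
          _ = w k l * x k ^ 2 * (w l k * x l ^ 2) := by ring)
    linarith [neg_abs_le (T k l * x k * x l)]
  have hrow : ∑ k, ∑ l, w k l * x k ^ 2 ≤ ∑ k, d k * x k ^ 2 := by
    simp_rw [← Finset.sum_mul]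
    gcongr with k
    exact hd k
  have hswap : ∑ k, ∑ l, w l k * x l ^ 2 = ∑ k, ∑ l, w k l * x k ^ 2 := Finset.sum_comm
  have hsum := Finset.sum_nonneg fun k (_ : k ∈ Finset.univ) =>
    Finset.sum_nonneg fun l (_ : l ∈ Finset.univ) => hterm k l
  simp only [Finset.sum_add_distrib, ← Finset.mul_sum, hswap] at hsum
  have hdiag (k : n) : ∑ l, diagonal d k l * x k * x l = d k * x k ^ 2 := by
    simp [diagonal_apply, ite_mul, sq, mul_assoc]
  simp only [Matrix.add_apply, add_mul, Finset.sum_add_distrib, hdiag]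
  linarith

variable {N : ℕ} {α lam : ℝ}

/-- Outer levels are the two lowest and the two highest ones. -/
def IsOuter (N k : ℕ) : Prop := k ≤ 1 ∨ N ≤ k + 1

instance (N k : ℕ) : Decidable (IsOuter N k) := inferInstanceAs (Decidable (_ ∨ _))

/-- The levels `k` on which the part of an outer outcome `j` lives: `j`, the next level inwards,
and all levels further out. -/
def InBlock (N j k : ℕ) : Prop := (j ≤ 1 ∧ k ≤ j + 1) ∨ (N ≤ j + 1 ∧ j ≤ k + 1)

instance (N j k : ℕ) : Decidable (InBlock N j k) := inferInstanceAs (Decidable (_ ∨ _))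

/-- The vector spanning the rank-one part of an outer outcome `j`; it vanishes for inner `j`. -/
noncomputable def blockVec (N : ℕ) (α : ℝ) (j k : Fin (N + 1)) : ℝ :=
  if InBlock N j k then √(mixProb N α j k) else 0

/-- What the rank-one parts leave of the off-diagonal entries of `gauss N lam`, with zero
diagonal. -/
noncomputable def residual (N : ℕ) (α lam : ℝ) : Matrix (Fin (N + 1)) (Fin (N + 1)) ℝ :=
  of fun k l => if k = l then 0 else gauss N lam k l - ∑ j, blockVec N α j k * blockVec N α j l

/-- The share of the residual entries `(k, l)` and `(l, k)` that outcome `k` takes up. -/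
noncomputable def share (N k l : ℕ) : ℝ :=
  if IsOuter N k then 0 else if IsOuter N l then 1 else 1 / 2

/-- The residual entries taken up by outcome `j`. Those between two outer levels, where both
shares vanish, go to outcome `2`. -/
noncomputable def correction (N : ℕ) (α lam : ℝ) (j : Fin (N + 1)) :
    Matrix (Fin (N + 1)) (Fin (N + 1)) ℝ :=
  of fun k l => residual N α lam k l * ((if j = k then share N k l else 0) +
    (if j = l then share N l k else 0) + if j = 2 then 1 - share N k l - share N l k else 0)

lemma blockVec_eq_zero {j : Fin (N + 1)} (hj : ¬IsOuter N j) (k : Fin (N + 1)) :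
    blockVec N α j k = 0 :=
  if_neg fun h => hj (by unfold InBlock at h; unfold IsOuter; lia)

lemma residual_apply_self (k : Fin (N + 1)) : residual N α lam k k = 0 := if_pos rfl

lemma residual_apply_of_ne {k l : Fin (N + 1)} (h : k ≠ l) :
    residual N α lam k l = gauss N lam k l - ∑ j, blockVec N α j k * blockVec N α j l := if_neg h

lemma isSymm_residual : (residual N α lam).IsSymm :=
  .ext fun k l => by simp only [residual, of_apply, (isSymm_gauss N lam).apply, eq_comm, mul_comm]

lemma isSymm_correction (j : Fin (N + 1)) : (correction N α lam j).IsSymm :=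
  .ext fun k l => by simp only [correction, of_apply, isSymm_residual.apply]; ring_nf

lemma sum_correction (k l : Fin (N + 1)) :
    ∑ j, correction N α lam j k l = residual N α lam k l := by
  simp only [correction, of_apply, ← Finset.mul_sum, Finset.sum_add_distrib,
    Finset.sum_ite_eq', Finset.mem_univ, if_true]
  ring

lemma correction_apply_self (j k : Fin (N + 1)) : correction N α lam j k k = 0 := by
  rw [correction, of_apply, residual_apply_self, zero_mul]

lemma val_two (hN : 4 ≤ N) : ((2 : Fin (N + 1)) : ℕ) = 2 := Nat.mod_eq_of_lt (by lia)

lemma one_sub_share_sub_share_eq_ite (k l : ℕ) :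
    1 - share N k l - share N l k = if IsOuter N k ∧ IsOuter N l then 1 else 0 := by
  by_cases hk : IsOuter N k <;> by_cases hl : IsOuter N l <;> norm_num [share, hk, hl]

lemma correction_eq_zero (hN : 4 ≤ N) {j : Fin (N + 1)} (hj : IsOuter N j) :
    correction N α lam j = 0 := by
  have hj2 : j ≠ 2 := by
    rintro rfl
    rw [val_two hN] at hj
    unfold IsOuter at hj
    lia
  ext k l
  simp only [correction, of_apply, if_neg hj2]
  split_ifs with hk hl hl
  all_goals simp_all [share]

lemma correction_apply_left {j : Fin (N + 1)} (hj : ¬IsOuter N j) (l : Fin (N + 1)) :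
    correction N α lam j j l = share N j l * residual N α lam j l := by
  obtain rfl | hl := eq_or_ne j l
  · rw [correction_apply_self, residual_apply_self, mul_zero]
  · simp [correction, one_sub_share_sub_share_eq_ite, hj, hl, mul_comm]

lemma abs_correction_apply_le {j k l : Fin (N + 1)} (hk : j ≠ k) (hl : j ≠ l) :
    |correction N α lam j k l| ≤
      if IsOuter N k ∧ IsOuter N l then |residual N α lam k l| else 0 := by
  simp only [correction, of_apply, if_neg hk, if_neg hl, one_sub_share_sub_share_eq_ite]
  split_ifs <;> simp

/-- The weights that make the part of an inner outcome diagonally dominant. -/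
noncomputable def correctionWeight (N : ℕ) (α lam κ : ℝ) (j k l : Fin (N + 1)) : ℝ :=
  if l = j then (if k = j then 0 else (1 - α) * coin N j - κ)
  else if k = j then correction N α lam j k l ^ 2 / ((1 - α) * coin N j - κ)
  else |correction N α lam j k l|

lemma sum_correctionWeight_self_le {κ : ℝ} (hα : α ∈ Set.Icc (0 : ℝ) 1) {j : Fin (N + 1)}
    (hκ : κ ≤ (1 - α) * coin N j) (h : ∑ l, correction N α lam j j l ^ 2 ≤
      (α + (1 - α) * coin N j) * ((1 - α) * coin N j - κ)) :
    ∑ l, correctionWeight N α lam κ j j l ≤ mixProb N α j j := by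
  have hq := mul_nonneg (sub_nonneg.2 hα.2) (coin_nonneg N j)
  have hqκ := sub_nonneg.2 hκ
  calc ∑ l, correctionWeight N α lam κ j j l
      ≤ ∑ l, correction N α lam j j l ^ 2 / ((1 - α) * coin N j - κ) := by
        gcongr with l
        simp only [correctionWeight, if_true]
        split_ifs
        · positivity
        · exact le_rfl
    _ ≤ α + (1 - α) * coin N j := by
        rw [← Finset.sum_div]
        exact div_le_of_le_mul₀ hqκ (add_nonneg hα.1 hq) h
    _ = mixProb N α j j := by rw [mixProb, if_pos rfl]

lemma sum_correctionWeight_le {κ : ℝ} {j k : Fin (N + 1)} (hk : k ≠ j)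
    (houter : ∑ l : Fin (N + 1),
      (if IsOuter N k ∧ IsOuter N l then |residual N α lam k l| else 0) ≤ κ) :
    ∑ l, correctionWeight N α lam κ j k l ≤ mixProb N α j k := by
  calc ∑ l, correctionWeight N α lam κ j k l
      ≤ ∑ l : Fin (N + 1), ((if l = j then (1 - α) * coin N j - κ else 0) +
          if IsOuter N k ∧ IsOuter N l then |residual N α lam k l| else 0) := by
        gcongr with l
        rw [correctionWeight, if_neg hk, if_neg hk]
        by_cases hl : l = j
        · rw [if_pos hl, if_pos hl]
          exact le_add_of_nonneg_right (ite_nonneg (abs_nonneg _) le_rfl)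
        · rw [if_neg hl, if_neg hl, zero_add]
          exact abs_correction_apply_le (Ne.symm hk) (Ne.symm hl)
    _ ≤ (1 - α) * coin N j - κ + κ := by
        rw [Finset.sum_add_distrib, Finset.sum_ite_eq', if_pos (Finset.mem_univ _)]
        gcongr
    _ = mixProb N α j k := by rw [mixProb, if_neg hk, sub_add_cancel, zero_add]

lemma posSemidef_diagonal_add_correction {κ : ℝ} (hα : α ∈ Set.Icc (0 : ℝ) 1) {j : Fin (N + 1)}
    (hκ : κ ≤ (1 - α) * coin N j)
    (houter : ∀ k : Fin (N + 1), ∑ l : Fin (N + 1),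
      (if IsOuter N k ∧ IsOuter N l then |residual N α lam k l| else 0) ≤ κ)
    (h : ∑ l, correction N α lam j j l ^ 2 ≤
      (α + (1 - α) * coin N j) * ((1 - α) * coin N j - κ)) :
    (diagonal (mixProb N α j) + correction N α lam j).PosSemidef := by
  have hqκ := sub_nonneg.2 hκ
  refine posSemidef_diagonal_add_of_sq_le_mul (w := correctionWeight N α lam κ j)
    (isSymm_correction j) (fun k l => ?_) (fun k l => ?_) fun k => ?_
  · unfold correctionWeight
    split_ifs <;> positivity
  · have hcancel (l : Fin (N + 1)) : correction N α lam j j l ^ 2 / ((1 - α) * coin N j - κ) *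
        ((1 - α) * coin N j - κ) = correction N α lam j j l ^ 2 :=
      div_mul_cancel_of_imp fun h0 => by
        rw [h0, mul_zero] at h
        exact (Finset.sum_eq_zero_iff_of_nonneg fun _ _ => sq_nonneg _).1
          (h.antisymm (Finset.sum_nonneg fun _ _ => sq_nonneg _)) l (Finset.mem_univ l)
    unfold correctionWeight
    split_ifs with hl hk hk
    · rw [hl, hk, correction_apply_self, zero_pow two_ne_zero, zero_mul]
    · rw [hl, mul_comm, hcancel, (isSymm_correction j).apply]
    · rw [hk, hcancel]
    · rw [(isSymm_correction j).apply k l, ← sq, sq_abs]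
  · obtain rfl | hk := eq_or_ne k j
    · exact sum_correctionWeight_self_le hα hκ h
    · exact sum_correctionWeight_le hk (houter k)

lemma splits_of_sum_correction_sq_le {κ : ℝ} (hN : 4 ≤ N) (hα : α ∈ Set.Icc (0 : ℝ) 1)
    (houter : ∀ k : Fin (N + 1), ∑ l : Fin (N + 1),
      (if IsOuter N k ∧ IsOuter N l then |residual N α lam k l| else 0) ≤ κ)
    (hκ : ∀ j : Fin (N + 1), ¬IsOuter N j → κ ≤ (1 - α) * coin N j)
    (h : ∀ j : Fin (N + 1), ¬IsOuter N j →
      ∑ l : Fin (N + 1), (share N j l * residual N α lam j l) ^ 2 ≤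
        (α + (1 - α) * coin N j) * ((1 - α) * coin N j - κ)) :
    Splits N α lam := by
  refine splits_of_diag_le (D := fun j => if IsOuter N j then
      vecMulVec (blockVec N α j) (star (blockVec N α j))
    else diagonal (mixProb N α j) + correction N α lam j) (fun j => ?_) (fun j k => ?_)
    fun k l hkl => ?_
  · split_ifs with hj
    · exact posSemidef_vecMulVec_self_star _
    · exact posSemidef_diagonal_add_correction hα (hκ j hj) houter
        (by simpa only [correction_apply_left hj] using h j hj)
  · have hp := mixProb_nonneg hα j k
    split_ifs with hj
    · rw [vecMulVec_apply, Pi.star_apply, star_trivial, blockVec]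
      split_ifs
      · rw [Real.mul_self_sqrt hp]
      · rwa [zero_mul]
    · rw [Matrix.add_apply, diagonal_apply_eq, correction_apply_self, add_zero]
  · calc _ = ∑ j, (blockVec N α j k * blockVec N α j l + correction N α lam j k l) := by
          refine Finset.sum_congr rfl fun j _ => ?_
          split_ifs with hj
          · simp [vecMulVec_apply, correction_eq_zero hN hj]
          · simp [diagonal_apply_ne _ hkl.ne, blockVec_eq_zero hj]
      _ = gauss N lam k l := by
          rw [Finset.sum_add_distrib, sum_correction, residual_apply_of_ne hkl.ne,
            add_sub_cancel]

end ManyLevels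

section ResidualEntries

variable {N : ℕ} {α lam : ℝ}

lemma mixProb_rev (j k : Fin (N + 1)) : mixProb N α j.rev k.rev = mixProb N α j k := by
  simp only [mixProb, Fin.rev_inj, coin, Fin.val_rev, Nat.add_sub_add_right,
    Nat.choose_symm (Nat.le_of_lt_succ j.2)]

lemma isOuter_rev {k : Fin (N + 1)} : IsOuter N k.rev ↔ IsOuter N k := by
  simp only [IsOuter, Fin.val_rev]
  lia

lemma inBlock_rev {j k : Fin (N + 1)} : InBlock N j.rev k.rev ↔ InBlock N j k := by
  simp only [InBlock, Fin.val_rev]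
  lia

lemma blockVec_rev (j k : Fin (N + 1)) : blockVec N α j.rev k.rev = blockVec N α j k := by
  simp only [blockVec, inBlock_rev, mixProb_rev]

lemma gauss_rev (k l : Fin (N + 1)) : gauss N lam k.rev l.rev = gauss N lam k l := by
  rw [gauss_apply, gauss_apply]
  congr 2
  simp only [Fin.val_rev]
  lia

lemma residual_rev (k l : Fin (N + 1)) :
    residual N α lam k.rev l.rev = residual N α lam k l := by
  simp only [residual, Matrix.of_apply, Fin.rev_inj, gauss_rev,
    ← Equiv.sum_comp Fin.revPerm fun j => blockVec N α j k.rev * blockVec N α j l.rev,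
    Fin.revPerm_apply, blockVec_rev]

lemma share_rev (k l : Fin (N + 1)) : share N k.rev l.rev = share N k l := by
  simp only [share, isOuter_rev]

lemma residual_eq_gauss {k l : Fin (N + 1)} (hkl : k ≠ l)
    (h : ∀ j ≤ N, ¬(InBlock N j k ∧ InBlock N j l)) : residual N α lam k l = gauss N lam k l := by
  rw [residual_apply_of_ne hkl, Finset.sum_eq_zero fun j _ => ?_, sub_zero]
  obtain hj | hj := not_and_or.1 (h j (Nat.le_of_lt_succ j.2)) <;> simp [blockVec, hj]

lemma blockVec_self_mul (hα : α ≤ 1) {j k : Fin (N + 1)} (hj : InBlock N j j) (hk : InBlock N j k)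
    (hkj : k ≠ j) : blockVec N α j j * blockVec N α j k = uN N j α := by
  rw [uN_eq_mul hα, mul_comm]
  simp [blockVec, mixProb, hj, hk, hkj, mul_comm]

lemma blockVec_mul_of_ne (hα : α ≤ 1) {j k l : Fin (N + 1)} (hk : InBlock N j k)
    (hl : InBlock N j l) (hkj : k ≠ j) (hlj : l ≠ j) :
    blockVec N α j k * blockVec N α j l = (1 - α) * coin N j := by
  have := mul_nonneg (sub_nonneg.2 hα) (coin_nonneg N j)
  simp [blockVec, mixProb, hk, hl, hkj, hlj, Real.mul_self_sqrt this]

lemma blockVec_mul_eq_zero {j k l : Fin (N + 1)} (h : ¬(InBlock N j k ∧ InBlock N j l)) :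
    blockVec N α j k * blockVec N α j l = 0 := by
  obtain h | h := not_and_or.1 h <;> simp [blockVec, h]

lemma residual_zero_one (hN : 4 ≤ N) (hα : α ≤ 1) {k l : Fin (N + 1)} (hk : (k : ℕ) = 0)
    (hl : (l : ℕ) = 1) : residual N α (uN N 0 α + uN N 1 α) k l = 0 := by
  have hkl : k ≠ l := by lia
  rw [residual_apply_of_ne hkl, Fintype.sum_eq_add k l hkl fun j hj => blockVec_mul_eq_zero ?_,
    blockVec_self_mul hα _ _ hkl.symm, mul_comm, blockVec_self_mul hα _ _ hkl, gauss_apply, hk, hl]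
  · simp
  all_goals unfold InBlock; lia

lemma residual_two_one (hN : 4 ≤ N) (hα : α ≤ 1) {k l : Fin (N + 1)} (hk : (k : ℕ) = 2)
    (hl : (l : ℕ) = 1) : residual N α (uN N 0 α + uN N 1 α) k l = uN N 0 α := by
  have hkl : k ≠ l := by lia
  rw [residual_apply_of_ne hkl, Fintype.sum_eq_single l fun j hj => blockVec_mul_eq_zero ?_,
    mul_comm, blockVec_self_mul hα _ _ hkl, gauss_apply, hk, hl]
  · simp
  all_goals unfold InBlock; lia

lemma residual_two_zero (hN : 4 ≤ N) (hα : α ≤ 1) {k l : Fin (N + 1)} (hk : (k : ℕ) = 2)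
    (hl : (l : ℕ) = 0) : residual N α lam k l = lam ^ 4 - (1 - α) * coin N 1 := by
  have h1 : ((1 : Fin (N + 1)) : ℕ) = 1 := Nat.mod_eq_of_lt (by lia)
  rw [residual_apply_of_ne (by lia), Fintype.sum_eq_single 1 fun j hj => blockVec_mul_eq_zero ?_,
    blockVec_mul_of_ne hα, gauss_apply, hk, hl, h1]
  · simp
  all_goals first | (unfold InBlock; lia) | lia

lemma abs_residual_outer_le (hN : 4 ≤ N) (hα : α ∈ Set.Icc (0 : ℝ) 1)
    (hlam : lam = uN N 0 α + uN N 1 α) {k l : Fin (N + 1)} (hk : IsOuter N k) (hl : IsOuter N l) :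
    |residual N α lam k l| ≤
      if ¬((k : ℕ) ≤ 1 ↔ (l : ℕ) ≤ 1) then lam ^ ((N - 2) ^ 2) else 0 := by
  have hmem : lam ∈ Set.Icc (0 : ℝ) 1 := hlam ▸ uN_add_uN_mem_Icc (by lia) hα
  unfold IsOuter at hk hl
  have hlow {k l : Fin (N + 1)} (hk : (k : ℕ) ≤ 1) (hl : (l : ℕ) ≤ 1) :
      residual N α lam k l = 0 := by
    obtain rfl | hkl := eq_or_ne k l
    · exact residual_apply_self k
    obtain ⟨hk, hl⟩ | ⟨hk, hl⟩ : (k : ℕ) = 0 ∧ (l : ℕ) = 1 ∨ (k : ℕ) = 1 ∧ (l : ℕ) = 0 := by lia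
    · rw [hlam, residual_zero_one hN hα.2 hk hl]
    · rw [hlam, ← isSymm_residual.apply, residual_zero_one hN hα.2 hl hk]
  split_ifs with h
  · rw [abs_nonpos_iff]
    by_cases hk1 : (k : ℕ) ≤ 1
    · exact hlow hk1 (by lia)
    · rw [← residual_rev]
      exact hlow (by rw [Fin.val_rev]; lia) (by rw [Fin.val_rev]; lia)
  · rw [residual_eq_gauss (by lia) (by unfold InBlock; lia), gauss_apply,
      abs_of_nonneg (pow_nonneg hmem.1 _)]
    exact pow_le_pow_of_le_one hmem.1 hmem.2 (Nat.pow_le_pow_left (by lia) 2)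

lemma sum_ite_le_two_mul {n : Type*} [Fintype n] {P : n → Prop} [DecidablePred P] {b : ℝ}
    (hb : 0 ≤ b) {f : n → Bool} (hf : Set.InjOn f {l | P l}) :
    ∑ l, (if P l then b else 0) ≤ 2 * b := by
  have hcard : (Finset.univ.filter P).card ≤ 2 :=
    Finset.card_le_card_of_injOn (t := Finset.univ) f (fun _ _ => Finset.mem_univ _)
      (by simpa using hf)
  rw [← Finset.sum_filter, Finset.sum_const, nsmul_eq_mul]
  gcongr
  exact_mod_cast hcard

lemma sum_abs_residual_outer_le (hN : 4 ≤ N) (hα : α ∈ Set.Icc (0 : ℝ) 1)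
    (hlam : lam = uN N 0 α + uN N 1 α) (k : Fin (N + 1)) :
    ∑ l : Fin (N + 1), (if IsOuter N k ∧ IsOuter N l then |residual N α lam k l| else 0) ≤
      2 * lam ^ ((N - 2) ^ 2) := by
  have hpow : 0 ≤ lam ^ ((N - 2) ^ 2) :=
    pow_nonneg (hlam ▸ (uN_add_uN_mem_Icc (by lia) hα).1) _
  calc _ ≤ ∑ l : Fin (N + 1),
        if IsOuter N l ∧ ¬((k : ℕ) ≤ 1 ↔ (l : ℕ) ≤ 1) then lam ^ ((N - 2) ^ 2) else 0 := by
        gcongr with l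
        split_ifs with h h' h'
        · simpa only [if_pos h'.2] using abs_residual_outer_le hN hα hlam h.1 h.2
        · simpa only [if_neg fun h'' => h' ⟨h.2, h''⟩] using
            abs_residual_outer_le hN hα hlam h.1 h.2
        · exact hpow
        · exact le_rfl
    _ ≤ 2 * lam ^ ((N - 2) ^ 2) := by
        refine sum_ite_le_two_mul hpow (f := fun l => decide ((l : ℕ) = 0 ∨ (l : ℕ) = N)) ?_
        rintro l ⟨hl, hkl⟩ m ⟨hm, hkm⟩ hlm
        rw [decide_eq_decide] at hlm
        unfold IsOuter at hl hm
        lia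

end ResidualEntries

section ResidualBounds

variable {N : ℕ} {α lam : ℝ}

lemma share_mul_gauss_sq_le (hlam : lam ∈ Set.Icc (0 : ℝ) 1) {j l : Fin (N + 1)} (hjl : j ≠ l)
    (hj : ¬IsOuter N j) (hl : ((j : ℤ) - l).natAbs = 1 → ¬IsOuter N l) :
    (share N j l * gauss N lam j l) ^ 2 ≤
      lam ^ 8 + if ((j : ℤ) - l).natAbs = 1 then lam ^ 2 / 4 else 0 := by
  rw [gauss_apply]
  split_ifs with h
  · rw [h, share, if_neg hj, if_neg (hl h)]
    linarith [pow_nonneg hlam.1 8, show (1 / 2 * lam ^ 1 ^ 2) ^ 2 = lam ^ 2 / 4 by ring]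
  · have hshare : share N j l ^ 2 ≤ 1 := by
      unfold share
      split_ifs <;> norm_num
    have hdist : 2 ≤ ((j : ℤ) - l).natAbs := by have := Fin.val_ne_of_ne hjl; lia
    have hexp : 8 ≤ ((j : ℤ) - l).natAbs ^ 2 * 2 :=
      Nat.mul_le_mul_right 2 (Nat.pow_le_pow_left hdist 2)
    calc (share N j l * lam ^ ((j : ℤ) - l).natAbs ^ 2) ^ 2
        = share N j l ^ 2 * lam ^ (((j : ℤ) - l).natAbs ^ 2 * 2) := by rw [mul_pow, ← pow_mul]
      _ ≤ 1 * lam ^ 8 := mul_le_mul hshare (pow_le_pow_of_le_one hlam.1 hlam.2 hexp)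
          (pow_nonneg hlam.1 _) zero_le_one
      _ = lam ^ 8 + 0 := by ring

lemma share_mul_residual_sq_le_of_lt (hN : 4 ≤ N) (hα : α ∈ Set.Icc (0 : ℝ) 1)
    (hlam : lam = uN N 0 α + uN N 1 α) {j l : Fin (N + 1)} (hj : ¬IsOuter N j) (hlj : l < j) :
    (share N j l * residual N α lam j l) ^ 2 ≤ lam ^ 8 +
      (if ((j : ℤ) - l).natAbs = 1 then lam ^ 2 / 4 + uN N 0 α ^ 2 else 0) +
      if ((j : ℤ) - l).natAbs = 2 then ((1 - α) * coin N 1) ^ 2 else 0 := by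
  have hmem : lam ∈ Set.Icc (0 : ℝ) 1 := hlam ▸ uN_add_uN_mem_Icc (by lia) hα
  have hlam8 := pow_nonneg hmem.1 8
  have hj2 : 2 ≤ (j : ℕ) ∧ (j : ℕ) + 2 ≤ N := by unfold IsOuter at hj; lia
  by_cases h : (j : ℕ) = 2
  · have hl : IsOuter N l := .inl (by lia)
    rw [share, if_neg hj, if_pos hl, one_mul]
    obtain hl0 | hl1 : (l : ℕ) = 0 ∨ (l : ℕ) = 1 := by lia
    · rw [residual_two_zero hN hα.2 h hl0, if_neg (by lia), if_pos (by lia)]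
      linarith [mul_nonneg (pow_nonneg hmem.1 4) (mul_nonneg (sub_nonneg.2 hα.2) (coin_nonneg N 1)),
        show (lam ^ 4 - (1 - α) * coin N 1) ^ 2 = lam ^ 8 -
          2 * (lam ^ 4 * ((1 - α) * coin N 1)) + ((1 - α) * coin N 1) ^ 2 by ring]
    · rw [hlam, residual_two_one hN hα.2 h hl1, if_pos (by lia), if_neg (by lia), ← hlam]
      linarith [sq_nonneg lam]
  · rw [residual_eq_gauss hlj.ne' (by unfold InBlock; lia)]
    refine (share_mul_gauss_sq_le hmem hlj.ne' hj (by unfold IsOuter; omega)).trans ?_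
    have hu := sq_nonneg (uN N 0 α)
    have hc := sq_nonneg ((1 - α) * coin N 1)
    split_ifs <;> linarith

lemma share_mul_residual_sq_le (hN : 4 ≤ N) (hα : α ∈ Set.Icc (0 : ℝ) 1)
    (hlam : lam = uN N 0 α + uN N 1 α) {j : Fin (N + 1)} (hj : ¬IsOuter N j) (l : Fin (N + 1)) :
    (share N j l * residual N α lam j l) ^ 2 ≤ lam ^ 8 +
      (if ((j : ℤ) - l).natAbs = 1 then lam ^ 2 / 4 + uN N 0 α ^ 2 else 0) +
      if ((j : ℤ) - l).natAbs = 2 then ((1 - α) * coin N 1) ^ 2 else 0 := by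
  obtain hlj | rfl | hjl := lt_trichotomy l j
  · exact share_mul_residual_sq_le_of_lt hN hα hlam hj hlj
  · rw [residual_apply_self, mul_zero, zero_pow two_ne_zero]
    positivity
  · have h := share_mul_residual_sq_le_of_lt hN hα hlam (isOuter_rev.not.2 hj)
      (Fin.rev_lt_rev.2 hjl)
    have hdist : ((j.rev : ℤ) - l.rev).natAbs = ((j : ℤ) - l).natAbs := by
      simp only [Fin.val_rev]
      lia
    rwa [share_rev, residual_rev, hdist] at h

lemma sum_ite_natAbs_sub_eq_le {n m : ℕ} (j : Fin n) {b : ℝ} (hb : 0 ≤ b) :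
    ∑ l : Fin n, (if ((j : ℤ) - l).natAbs = m then b else 0) ≤ 2 * b :=
  sum_ite_le_two_mul hb (f := fun l => decide (l < j)) fun k hk l hl h => by
    simp only [Set.mem_ofPred_eq, decide_eq_decide] at hk hl h
    omega

lemma sum_share_mul_residual_sq_le (hN : 4 ≤ N) (hα : α ∈ Set.Icc (0 : ℝ) 1)
    (hlam : lam = uN N 0 α + uN N 1 α) {j : Fin (N + 1)} (hj : ¬IsOuter N j) :
    ∑ l : Fin (N + 1), (share N j l * residual N α lam j l) ^ 2 ≤ (N + 1) * lam ^ 8 +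
      lam ^ 2 / 2 + 2 * uN N 0 α ^ 2 + 2 * ((1 - α) * coin N 1) ^ 2 := by
  refine (Finset.sum_le_sum fun l _ => share_mul_residual_sq_le hN hα hlam hj l).trans ?_
  simp only [Finset.sum_add_distrib, Finset.sum_const, Finset.card_univ, Fintype.card_fin,
    nsmul_eq_mul, Nat.cast_add, Nat.cast_one]
  linarith [sum_ite_natAbs_sub_eq_le (m := 1) j
      (by positivity : 0 ≤ lam ^ 2 / 4 + uN N 0 α ^ 2),
    sum_ite_natAbs_sub_eq_le (m := 2) j (sq_nonneg ((1 - α) * coin N 1))]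

lemma uN_add_uN_sq_le (hα : α ∈ Set.Icc (0 : ℝ) 1) (N : ℕ) :
    (uN N 0 α + uN N 1 α) ^ 2 ≤ (coin N 0 + coin N 1) * (1 - α) *
      (2 * α + (coin N 0 + coin N 1) * (1 - α)) := by
  have hq₀ := coin_mul_one_sub_nonneg hα.2 N 0
  have hq₁ := coin_mul_one_sub_nonneg hα.2 N 1
  have hmul : 2 * (uN N 0 α * uN N 1 α) ≤
      coin N 0 * (1 - α) * (α + coin N 1 * (1 - α)) +
        coin N 1 * (1 - α) * (α + coin N 0 * (1 - α)) := by
    refine two_mul_le_add_of_sq_le_mul (mul_nonneg hq₀ (add_nonneg hα.1 hq₁))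
      (mul_nonneg hq₁ (add_nonneg hα.1 hq₀)) (le_of_eq ?_)
    rw [mul_pow, uN_sq hα, uN_sq hα]
    ring
  linarith [uN_sq hα N 0, uN_sq hα N 1]

lemma choose_two_le_choose {n j : ℕ} (h2 : 2 ≤ j) (hj : j + 2 ≤ n) :
    n.choose 2 ≤ n.choose j := by
  have below_half : ∀ i, 2 ≤ i → 2 * i ≤ n → n.choose 2 ≤ n.choose i := by
    intro i hi
    induction i, hi using Nat.le_induction with
    | base => exact fun _ => le_rfl
    | succ i _ ih =>
      exact fun h => (ih (by lia)).trans (Nat.choose_le_succ_of_lt_half_left (by lia))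
  obtain h | h := le_total (2 * j) n
  · exact below_half j h2 h
  · rw [← Nat.choose_symm (by lia : j ≤ n)]
    exact below_half (n - j) (by lia) (by lia)

lemma coin_two_le_coin {j : ℕ} (h2 : 2 ≤ j) (hj : j + 2 ≤ N) : coin N 2 ≤ coin N j := by
  unfold coin
  gcongr
  exact choose_two_le_choose h2 hj

lemma pow_four_le_of_sq_le {x : ℝ} (hα : α ∈ Set.Icc (0 : ℝ) 1)
    (hx : x ^ 2 ≤ 5 / 16 * (1 - α) * (2 * α + 5 / 16 * (1 - α))) : x ^ 4 ≤ (1 - α) / 8 := by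
  have h0 := hα.1
  have he := sub_nonneg.2 hα.2
  have hquad : (1 - α) * (2 * α + 5 / 16 * (1 - α)) ≤ 16 / 27 := by
    linarith [sq_nonneg (27 * α - 11)]
  calc x ^ 4 = (x ^ 2) ^ 2 := by ring
    _ ≤ (5 / 16 * (1 - α) * (2 * α + 5 / 16 * (1 - α))) ^ 2 := by gcongr
    _ = 25 / 256 * (1 - α) * ((1 - α) * (2 * α + 5 / 16 * (1 - α))) *
        (2 * α + 5 / 16 * (1 - α)) := by ring
    _ ≤ 25 / 256 * (1 - α) * (16 / 27) * 2 := by gcongr; linarith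
    _ ≤ (1 - α) / 8 := by linarith

lemma coin_four : coin 4 0 = 1 / 16 ∧ coin 4 1 = 1 / 4 ∧ coin 4 2 = 3 / 8 := by
  norm_num [coin, Nat.choose]

lemma sum_share_mul_residual_four (hα : α ≤ 1) (hlam : lam = uN 4 0 α + uN 4 1 α) :
    ∑ l : Fin (4 + 1), (share 4 2 l * residual 4 α lam 2 l) ^ 2 =
      2 * (lam ^ 4 - (1 - α) / 4) ^ 2 + 2 * uN 4 0 α ^ 2 := by
  have h₀ : residual 4 α lam 2 0 = lam ^ 4 - (1 - α) * coin 4 1 :=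
    residual_two_zero le_rfl hα rfl rfl
  have h₁ : residual 4 α lam 2 1 = uN 4 0 α := by
    rw [hlam, residual_two_one le_rfl hα rfl rfl]
  have h₃ : residual 4 α lam 2 3 = uN 4 0 α := (residual_rev 2 1).trans h₁
  have h₄ : residual 4 α lam 2 4 = lam ^ 4 - (1 - α) * coin 4 1 := (residual_rev 2 0).trans h₀
  have hshare : share 4 2 0 = 1 ∧ share 4 2 1 = 1 ∧ share 4 2 3 = 1 ∧ share 4 2 4 = 1 := by
    norm_num [share, IsOuter]
  rw [Fin.sum_univ_five, h₀, h₁, residual_apply_self, h₃, h₄, coin_four.2.1]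
  simp only [Fin.coe_ofNat_eq_mod, Nat.zero_mod, Nat.one_mod, Nat.reduceMod, Nat.reduceAdd, hshare]
  ring

lemma splits_four_levels (hα : α ∈ Set.Icc (0 : ℝ) 1) :
    Splits 4 α (uN 4 0 α + uN 4 1 α) := by
  generalize hlam : uN 4 0 α + uN 4 1 α = lam
  obtain ⟨hc₀, hc₁, hc₂⟩ := coin_four
  have hlam4 : lam ^ 4 ≤ (1 - α) / 8 := by
    have hsq := uN_add_uN_sq_le hα 4
    rw [hlam, hc₀, hc₁] at hsq
    exact pow_four_le_of_sq_le hα (by linarith)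
  have he := sub_nonneg.2 hα.2
  have hinner {j : Fin (4 + 1)} (hj : ¬IsOuter 4 j) : j = 2 := by
    unfold IsOuter at hj
    lia
  refine splits_of_sum_correction_sq_le (κ := 2 * lam ^ 4) le_rfl hα
    (sum_abs_residual_outer_le le_rfl hα hlam.symm) (fun j hj => ?_) fun j hj => ?_ <;>
    obtain rfl := hinner hj
  · rw [val_two le_rfl, hc₂]
    linarith
  · rw [val_two le_rfl, sum_share_mul_residual_four hα.2 hlam.symm, uN_sq hα, hc₀, hc₂]
    have hquad : lam ^ 4 * lam ^ 4 ≤ lam ^ 4 * ((1 - α) / 8) := by gcongr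
    have hlin : α * lam ^ 4 ≤ α * ((1 - α) / 8) := mul_le_mul_of_nonneg_left hlam4 hα.1
    linarith [sq_nonneg (1 - α)]

lemma sixteen_mul_succ_le_two_pow {n : ℕ} (hn : 5 ≤ n) : 16 * (n + 1) ≤ 3 * 2 ^ n := by
  induction n, hn using Nat.le_induction with
  | base => norm_num
  | succ n _ ih => rw [pow_succ]; lia

lemma eight_mul_succ_sq_le_two_pow {n : ℕ} (hn : 5 ≤ n) : 8 * (n + 1) ^ 2 ≤ 9 * 2 ^ n := by
  induction n, hn using Nat.le_induction with
  | base => norm_num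
  | succ n _ ih => rw [pow_succ 2]; nlinarith

lemma coin_zero_add_coin_one (N : ℕ) : coin N 0 + coin N 1 = (N + 1) / 2 ^ N := by
  simp only [coin, Nat.choose_zero_right, Nat.choose_one_right, Nat.cast_one, ← add_div, add_comm]

lemma coin_zero_add_coin_one_le_of_five_le (hN : 5 ≤ N) : coin N 0 + coin N 1 ≤ 3 / 16 := by
  rw [coin_zero_add_coin_one, div_le_div_iff₀ (by positivity) (by norm_num)]
  have : (16 : ℝ) * (N + 1) ≤ 3 * 2 ^ N := by exact_mod_cast sixteen_mul_succ_le_two_pow hN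
  linarith

lemma succ_mul_coin_zero_add_coin_one_le (hN : 5 ≤ N) :
    (N + 1) * (coin N 0 + coin N 1) ≤ 9 / 8 := by
  rw [coin_zero_add_coin_one, ← mul_div_assoc, div_le_div_iff₀ (by positivity) (by norm_num)]
  have : (8 : ℝ) * (N + 1) ^ 2 ≤ 9 * 2 ^ N := by exact_mod_cast eight_mul_succ_sq_le_two_pow hN
  linarith

lemma uN_add_uN_sq_le_mul_coin (hN : 5 ≤ N) (hα : α ∈ Set.Icc (0 : ℝ) 1) :
    (uN N 0 α + uN N 1 α) ^ 2 ≤ 16 / 29 * (coin N 0 + coin N 1) := by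
  have := hα.1
  have he := sub_nonneg.2 hα.2
  have hc := add_nonneg (coin_nonneg N 0) (coin_nonneg N 1)
  calc (uN N 0 α + uN N 1 α) ^ 2
      ≤ (coin N 0 + coin N 1) * (1 - α) * (2 * α + (coin N 0 + coin N 1) * (1 - α)) :=
        uN_add_uN_sq_le hα N
    _ ≤ (coin N 0 + coin N 1) * (1 - α) * (2 * α + 3 / 16 * (1 - α)) := by
        gcongr
        exact coin_zero_add_coin_one_le_of_five_le hN
    _ = (1 - α) * (2 * α + 3 / 16 * (1 - α)) * (coin N 0 + coin N 1) := by ring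
    _ ≤ 16 / 29 * (coin N 0 + coin N 1) := by
        gcongr
        linarith [sq_nonneg (29 * (1 - α) - 16)]

lemma uN_add_uN_sq_le_one_div_nine (hN : 5 ≤ N) (hα : α ∈ Set.Icc (0 : ℝ) 1) :
    (uN N 0 α + uN N 1 α) ^ 2 ≤ 1 / 9 := by
  linarith [uN_add_uN_sq_le_mul_coin hN hα, coin_zero_add_coin_one_le_of_five_le hN]

lemma succ_mul_uN_add_uN_sq_le_one (hN : 5 ≤ N) (hα : α ∈ Set.Icc (0 : ℝ) 1) :
    (N + 1) * (uN N 0 α + uN N 1 α) ^ 2 ≤ 1 := by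
  calc (N + 1) * (uN N 0 α + uN N 1 α) ^ 2
      ≤ (N + 1) * (16 / 29 * (coin N 0 + coin N 1)) := by
        gcongr
        exact uN_add_uN_sq_le_mul_coin hN hα
    _ ≤ 1 := by linarith [succ_mul_coin_zero_add_coin_one_le hN]

lemma uN_add_uN_pow_eight_le (hN : 5 ≤ N) (hα : α ∈ Set.Icc (0 : ℝ) 1) :
    (uN N 0 α + uN N 1 α) ^ 8 ≤ (1 / 9) ^ 3 * (uN N 0 α + uN N 1 α) ^ 2 := by
  calc (uN N 0 α + uN N 1 α) ^ 8
      = ((uN N 0 α + uN N 1 α) ^ 2) ^ 3 * (uN N 0 α + uN N 1 α) ^ 2 := by ring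
    _ ≤ (1 / 9) ^ 3 * (uN N 0 α + uN N 1 α) ^ 2 := by
        gcongr
        exact uN_add_uN_sq_le_one_div_nine hN hα

lemma succ_mul_uN_add_uN_pow_eight_le (hN : 5 ≤ N) (hα : α ∈ Set.Icc (0 : ℝ) 1) :
    (N + 1) * (uN N 0 α + uN N 1 α) ^ 8 ≤ (1 / 9) ^ 2 * (uN N 0 α + uN N 1 α) ^ 2 := by
  calc (N + 1) * (uN N 0 α + uN N 1 α) ^ 8
      = (N + 1) * (uN N 0 α + uN N 1 α) ^ 2 * ((uN N 0 α + uN N 1 α) ^ 2) ^ 2 *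
          (uN N 0 α + uN N 1 α) ^ 2 := by ring
    _ ≤ 1 * (1 / 9) ^ 2 * (uN N 0 α + uN N 1 α) ^ 2 := by
        gcongr
        · exact succ_mul_uN_add_uN_sq_le_one hN hα
        · exact uN_add_uN_sq_le_one_div_nine hN hα
    _ = (1 / 9) ^ 2 * (uN N 0 α + uN N 1 α) ^ 2 := by rw [one_mul]

lemma coin_one_eq (N : ℕ) : coin N 1 = N * coin N 0 := by
  simp [coin, div_eq_mul_inv]

lemma coin_two_eq (N : ℕ) : coin N 2 = N * (N - 1) / 2 * coin N 0 := by
  simp [coin, Nat.cast_choose_two, div_eq_mul_inv]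

lemma two_mul_uN_add_uN_pow_eight_le (hN : 5 ≤ N) (hα : α ∈ Set.Icc (0 : ℝ) 1) :
    2 * (uN N 0 α + uN N 1 α) ^ 8 ≤ (1 - α) * coin N 2 := by
  have he := sub_nonneg.2 hα.2
  have hN' : (5 : ℝ) ≤ N := by exact_mod_cast hN
  have hs : coin N 0 + coin N 1 ≤ coin N 2 := by
    rw [coin_one_eq, coin_two_eq, ← one_add_mul]
    gcongr
    · exact coin_nonneg N 0
    · nlinarith
  have hs1 := coin_zero_add_coin_one_le (by lia : 1 ≤ N)
  have hsq : (uN N 0 α + uN N 1 α) ^ 2 ≤ coin N 2 * (1 - α) * 2 := by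
    refine (uN_add_uN_sq_le hα N).trans ?_
    have hq := mul_le_mul_of_nonneg_right hs1 he
    have hq0 := mul_nonneg (add_nonneg (coin_nonneg N 0) (coin_nonneg N 1)) he
    gcongr
    · linarith [hα.1]
    · exact coin_mul_one_sub_nonneg hα.2 N 2
    · linarith [hα.1]
  linarith [coin_mul_one_sub_nonneg hα.2 N 2, uN_add_uN_pow_eight_le hN hα]

lemma residual_budget (hN : 5 ≤ N) (hα : α ∈ Set.Icc (0 : ℝ) 1) :
    (N + 1) * (uN N 0 α + uN N 1 α) ^ 8 + (uN N 0 α + uN N 1 α) ^ 2 / 2 + 2 * uN N 0 α ^ 2 +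
        2 * ((1 - α) * coin N 1) ^ 2 ≤
      (α + (1 - α) * coin N 2) * ((1 - α) * coin N 2 - 2 * (uN N 0 α + uN N 1 α) ^ 8) := by
  have hsq := uN_add_uN_sq_le hα N
  have hlam8 := uN_add_uN_pow_eight_le hN hα
  have hsum8 := succ_mul_uN_add_uN_pow_eight_le hN hα
  have hu := uN_sq hα N 0
  have hN' : (5 : ℝ) ≤ N := by exact_mod_cast hN
  have hη := coin_mul_one_sub_nonneg hα.2 N 0
  have hp : α + (1 - α) * coin N 2 ≤ 1 := by
    linarith [mul_le_mul_of_nonneg_left (coin_le_one N 2) (sub_nonneg.2 hα.2)]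
  have hp8 : (α + (1 - α) * coin N 2) * (uN N 0 α + uN N 1 α) ^ 8 ≤
      (uN N 0 α + uN N 1 α) ^ 8 :=
    mul_le_of_le_one_left (by positivity) hp
  rw [coin_one_eq, coin_two_eq] at *
  generalize hK : (N * (N - 1) / 2 : ℝ) = K at *
  generalize uN N 0 α + uN N 1 α = lam at *
  have hlin : 33 / 32 * ((N : ℝ) + 1) + 2 ≤ K := by nlinarith only [hN', hK]
  have hquad : 33 / 64 * ((N : ℝ) + 1) ^ 2 + 2 + 2 * N ^ 2 ≤ K ^ 2 := by
    have h2 : 2 * (N : ℝ) ≤ K := by nlinarith only [hN', hK]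
    nlinarith only [hN', mul_le_mul h2 h2 (by positivity) (by linarith)]
  have hlinη := mul_le_mul_of_nonneg_right hlin (mul_nonneg hη hα.1)
  have hquadη := mul_le_mul_of_nonneg_right hquad (mul_nonneg hη hη)
  nlinarith only [hp8, hsum8, hlam8, hsq, hu, hlinη, hquadη, sq_nonneg lam]

lemma splits_many_levels (hN : 5 ≤ N) (hα : α ∈ Set.Icc (0 : ℝ) 1) :
    Splits N α (uN N 0 α + uN N 1 α) := by
  have hmem := uN_add_uN_mem_Icc (by lia : 1 ≤ N) hα
  have hcoin {j : Fin (N + 1)} (hj : ¬IsOuter N j) : (1 - α) * coin N 2 ≤ (1 - α) * coin N j :=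
    mul_le_mul_of_nonneg_left (by unfold IsOuter at hj; exact coin_two_le_coin (by lia) (by lia))
      (sub_nonneg.2 hα.2)
  have hκ := two_mul_uN_add_uN_pow_eight_le hN hα
  refine splits_of_sum_correction_sq_le (κ := 2 * (uN N 0 α + uN N 1 α) ^ 8) (by lia) hα
    (fun k => ?_) (fun j hj => hκ.trans (hcoin hj)) fun j hj => ?_
  · refine (sum_abs_residual_outer_le (by lia) hα rfl k).trans ?_
    have hexp : 3 ^ 2 ≤ (N - 2) ^ 2 := Nat.pow_le_pow_left (by lia) 2
    gcongr 2 * ?_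
    exact pow_le_pow_of_le_one hmem.1 hmem.2 (by lia)
  · calc _ ≤ _ := sum_share_mul_residual_sq_le (by lia) hα rfl hj
      _ ≤ _ := residual_budget hN hα
      _ ≤ (α + (1 - α) * coin N j) * ((1 - α) * coin N j - 2 * (uN N 0 α + uN N 1 α) ^ 8) := by
        have h0 := add_nonneg hα.1 (mul_nonneg (sub_nonneg.2 hα.2) (coin_nonneg N j))
        have := sub_nonneg.2 hκ
        gcongr ?_ * ?_ <;> linarith [hcoin hj]

end ResidualBounds

/-! ### Asymptotics -/

section Asymptotics

variable {N : ℕ} {α : ℝ}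

lemma splits_uN_add_uN (hN : 1 ≤ N) (hN2 : N ≠ 2) (hα : α ∈ Set.Icc (0 : ℝ) 1) :
    Splits N α (uN N 0 α + uN N 1 α) := by
  obtain rfl | rfl | rfl | h : N = 1 ∨ N = 3 ∨ N = 4 ∨ 5 ≤ N := by lia
  · exact splits_one_level hα
  · exact splits_three_levels hα
  · exact splits_four_levels hα
  · exact splits_many_levels h hα

lemma kN_eq (N : ℕ) : kN N = √(coin N 0) + √(coin N 1) := by
  have hpow : (2 : ℝ) ^ ((N : ℝ) / 2) = √(2 ^ N) := by
    rw [Real.sqrt_eq_rpow, ← Real.rpow_natCast, ← Real.rpow_mul zero_le_two, mul_one_div]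
  rw [kN, hpow, coin, coin, Real.sqrt_div' _ (by positivity), Real.sqrt_div' _ (by positivity),
    Nat.choose_zero_right, Nat.choose_one_right, Nat.cast_one, Real.sqrt_one, add_div]

lemma kN_nonneg (N : ℕ) : 0 ≤ kN N := by
  rw [kN_eq]
  positivity

lemma uN_add_uN_le_kN_mul (hα : α ≤ 1) (N : ℕ) : uN N 0 α + uN N 1 α ≤ kN N * √(1 - α) := by
  have h (k : ℕ) : uN N k α ≤ √(coin N k) * √(1 - α) := by
    rw [uN_eq_mul hα, Real.sqrt_mul (coin_nonneg N k)]
    refine mul_le_of_le_one_right (by positivity) (Real.sqrt_le_one.2 ?_)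
    linarith [mul_le_mul_of_nonneg_right (coin_le_one N k) (sub_nonneg.2 hα)]
  rw [kN_eq, add_mul]
  exact add_le_add (h 0) (h 1)

lemma sqrt_mul_sqrt_le_uN (hα : α ≤ 1) (N k : ℕ) :
    √(coin N k) * √(1 - α) * √α ≤ uN N k α := by
  rw [uN_eq_mul hα, Real.sqrt_mul (coin_nonneg N k)]
  gcongr
  exact le_add_of_nonneg_right (coin_mul_one_sub_nonneg hα N k)

lemma kN_mul_sub_le_uN_add_uN (hα : α ∈ Set.Icc (0 : ℝ) 1) (N : ℕ) :
    kN N * √(1 - α) - kN N * ((1 - α) * √(1 - α)) ≤ uN N 0 α + uN N 1 α := by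
  have hsqrt : α ≤ √α := Real.le_sqrt_of_sq_le (pow_le_of_le_one hα.1 hα.2 two_ne_zero)
  calc kN N * √(1 - α) - kN N * ((1 - α) * √(1 - α)) = kN N * √(1 - α) * α := by ring
    _ ≤ kN N * √(1 - α) * √α :=
        mul_le_mul_of_nonneg_left hsqrt (mul_nonneg (kN_nonneg N) (Real.sqrt_nonneg _))
    _ = √(coin N 0) * √(1 - α) * √α + √(coin N 1) * √(1 - α) * √α := by rw [kN_eq]; ring
    _ ≤ uN N 0 α + uN N 1 α :=
        add_le_add (sqrt_mul_sqrt_le_uN hα.2 N 0) (sqrt_mul_sqrt_le_uN hα.2 N 1)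

lemma beta_le_kN_mul_add (hα : α ≤ 1) (N : ℕ) : beta N 0 1 α ≤ kN N * √(1 - α) + (1 - α) := by
  have hrest : (1 - α) * (1 - coin N 0 - coin N 1) ≤ 1 - α :=
    mul_le_of_le_one_right (sub_nonneg.2 hα) (by linarith [coin_nonneg N 0, coin_nonneg N 1])
  rw [beta_eq]
  linarith [uN_add_uN_le_kN_mul hα N]

lemma div_rpow_three_halves (h0 : 0 ≤ α) (h1 : α ≤ 1) :
    ((1 - α) / α) ^ (3 / 2 : ℝ) = (1 - α) * √(1 - α) / (α * √α) := by
  have h : 0 ≤ (1 - α) / α := div_nonneg (sub_nonneg.2 h1) h0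
  rw [show (3 / 2 : ℝ) = 1 + 1 / 2 by norm_num, Real.rpow_add_of_nonneg h (by norm_num)
    (by norm_num), Real.rpow_one, ← Real.sqrt_eq_rpow, Real.sqrt_div (sub_nonneg.2 h1),
    div_mul_div_comm]

lemma mul_sqrt_div_sqrt_le_div_rpow (h0 : 0 < α) (h1 : α ≤ 1) :
    (1 - α) * √(1 - α) / √α ≤ ((1 - α) / α) ^ (3 / 2 : ℝ) := by
  have := sub_nonneg.2 h1
  rw [div_rpow_three_halves h0.le h1]
  gcongr
  exact mul_le_of_le_one_left (Real.sqrt_nonneg α) h1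

lemma one_le_kN_two : 1 ≤ kN 2 := by
  rw [kN_eq, show coin 2 0 = 1 / 4 by norm_num [coin], show coin 2 1 = 1 / 2 by norm_num [coin]]
  linarith [show (1 / 2 : ℝ) ≤ √(1 / 4) from Real.le_sqrt_of_sq_le (by norm_num),
    show (1 / 2 : ℝ) ≤ √(1 / 2) from Real.le_sqrt_of_sq_le (by norm_num)]

lemma sq_div_uN_two_le (h0 : 0 < α) (h1 : α < 1) :
    (1 - α) ^ 2 / (16 * uN 2 0 α) ≤ (1 - α) * √(1 - α) / √α / 8 := by
  have he := sub_pos.2 h1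
  have hu : 1 / 2 * √(1 - α) * √α ≤ uN 2 0 α := by
    refine le_trans ?_ (sqrt_mul_sqrt_le_uN h1.le 2 0)
    rw [show coin 2 0 = 1 / 4 by norm_num [coin]]
    gcongr
    exact Real.le_sqrt_of_sq_le (by norm_num)
  calc (1 - α) ^ 2 / (16 * uN 2 0 α)
      ≤ (1 - α) ^ 2 / (16 * (1 / 2 * √(1 - α) * √α)) := by gcongr
    _ = (1 - α) * √(1 - α) / √α / 8 := by
        rw [div_div, div_eq_div_iff (by positivity) (by positivity)]
        linear_combination (-(8 * (1 - α) * √α)) * Real.mul_self_sqrt he.le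

lemma le_unitInv_alphaN_two (h0 : 0 < α) (h1 : α ≤ 1) :
    uN 2 0 α + uN 2 1 α - ((1 - α) / α) ^ (3 / 2 : ℝ) / 8 ≤ unitInv (alphaN 2) α := by
  have hα : α ∈ Set.Icc (0 : ℝ) 1 := ⟨h0.le, h1⟩
  obtain rfl | h1 := h1.eq_or_lt
  · simpa [uN_one] using (unitInv_mem (bijOn_alphaN (N := 2) one_le_two) hα).1
  · obtain ⟨hsplit, hmem⟩ := splits_two_levels h0 h1
    linarith [hsplit.le_unitInv_alphaN one_le_two hα hmem, sq_div_uN_two_le h0 h1,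
      mul_sqrt_div_sqrt_le_div_rpow h0 h1.le]

lemma kN_mul_sub_le_unitInv_alphaN (hN : 1 ≤ N) (h0 : 0 < α) (h1 : α ≤ 1) :
    kN N * √(1 - α) - 3 / 2 * kN N * ((1 - α) / α) ^ (3 / 2 : ℝ) ≤ unitInv (alphaN N) α := by
  have hα : α ∈ Set.Icc (0 : ℝ) 1 := ⟨h0.le, h1⟩
  have := sub_nonneg.2 h1
  have hz : (1 - α) * √(1 - α) ≤ ((1 - α) / α) ^ (3 / 2 : ℝ) :=
    (le_div_self (by positivity) (Real.sqrt_pos.2 h0) (Real.sqrt_le_one.2 h1)).trans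
      (mul_sqrt_div_sqrt_le_div_rpow h0 h1)
  have hkz := mul_le_mul_of_nonneg_left hz (kN_nonneg N)
  have hz0 : 0 ≤ ((1 - α) / α) ^ (3 / 2 : ℝ) := by positivity
  have hlow := kN_mul_sub_le_uN_add_uN hα N
  obtain rfl | hN2 := eq_or_ne N 2
  · linarith [le_unitInv_alphaN_two h0 h1, mul_le_mul_of_nonneg_right one_le_kN_two hz0]
  · linarith [(splits_uN_add_uN hN hN2 hα).le_unitInv_alphaN hN hα (uN_add_uN_mem_Icc hN hα),
      mul_nonneg (kN_nonneg N) hz0]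

lemma abs_unitInv_alphaN_sub_le (hN : 1 ≤ N) (h0 : 0 < α) (h1 : α ≤ 1) :
    |unitInv (alphaN N) α - kN N * √(1 - α)| ≤
      1 - α + 3 / 2 * kN N * ((1 - α) / α) ^ (3 / 2 : ℝ) := by
  have hup := ((splits_unitInv_alphaN hN ⟨h0.le, h1⟩).le_beta hN h1).trans
    (beta_le_kN_mul_add h1 N)
  have hlow := kN_mul_sub_le_unitInv_alphaN hN h0 h1
  have hz0 : 0 ≤ 3 / 2 * kN N * ((1 - α) / α) ^ (3 / 2 : ℝ) :=
    mul_nonneg (mul_nonneg (by norm_num) (kN_nonneg N)) (by positivity)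
  rw [abs_le]
  constructor <;> linarith

lemma isBigO_one_sub_of_abs_le {f : ℝ → ℝ} {c : ℝ}
    (h : ∀ α : ℝ, 1 / 2 ≤ α → α ≤ 1 → |f α| ≤ c * (1 - α)) :
    f =O[𝓝[≤] 1] fun α : ℝ => 1 - α := by
  refine Asymptotics.IsBigO.of_bound c ?_
  filter_upwards [Icc_mem_nhdsLE (by norm_num : (1 / 2 : ℝ) < 1)] with α hα
  rw [Real.norm_eq_abs, Real.norm_eq_abs, abs_of_nonneg (sub_nonneg.2 hα.2)]
  exact h α hα.1 hα.2

lemma isBigO_unitInv_alphaN (hN : 1 ≤ N) :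
    (fun α : ℝ => unitInv (alphaN N) α - kN N * √(1 - α)) =O[𝓝[≤] 1] fun α : ℝ => 1 - α := by
  refine isBigO_one_sub_of_abs_le (c := 1 + 6 * kN N) fun α h0 h1 => ?_
  have hpos : 0 < α := by linarith
  have := sub_nonneg.2 h1
  have hsqrt : 1 / 2 ≤ √α := Real.le_sqrt_of_sq_le (by linarith)
  have hsqrt' : √(1 - α) ≤ 1 := Real.sqrt_le_one.2 (by linarith)
  have hrpow : ((1 - α) / α) ^ (3 / 2 : ℝ) ≤ 4 * (1 - α) := by
    rw [div_rpow_three_halves hpos.le h1]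
    calc (1 - α) * √(1 - α) / (α * √α) ≤ (1 - α) * 1 / (1 / 2 * (1 / 2)) := by gcongr
      _ = 4 * (1 - α) := by ring
  linarith [abs_unitInv_alphaN_sub_le hN hpos h1, mul_le_mul_of_nonneg_left hrpow (kN_nonneg N)]

lemma isBigO_unitInv_upperN (hN : 1 ≤ N) :
    (fun α : ℝ => unitInv (upperN N) α - kN N * √(1 - α)) =O[𝓝[≤] 1] fun α : ℝ => 1 - α := by
  refine isBigO_one_sub_of_abs_le (c := 1 + kN N) fun α h0 h1 => ?_
  have hα : α ∈ Set.Icc (0 : ℝ) 1 := ⟨by linarith, h1⟩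
  have he := sub_nonneg.2 h1
  have hk := kN_nonneg N
  have hsqrt : √(1 - α) ≤ 1 := Real.sqrt_le_one.2 (by linarith)
  have hup := beta_le_kN_mul_add h1 N
  have hlow := kN_mul_sub_le_uN_add_uN hα N
  have hrest := mul_nonneg he (by linarith [coin_zero_add_coin_one_le hN] :
    0 ≤ 1 - coin N 0 - coin N 1)
  have hke : kN N * ((1 - α) * √(1 - α)) ≤ kN N * (1 - α) := by
    gcongr
    exact mul_le_of_le_one_right he hsqrt
  have hke0 := mul_nonneg hk he
  rw [upperN, unitInv_unitInv (bijOn_beta hN) hα, abs_le]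
  constructor
  · rw [beta_eq]
    linarith
  · linarith

end Asymptotics

end CoherenceIncompat

open CoherenceIncompat in
theorem proposition5 (N : ℕ) (hN : 1 ≤ N) :
    -- the maximum defining `α_N` exists, and the inverse functions below make sense
    (∀ lam ∈ Set.Icc (0 : ℝ) 1, IsGreatest (compatWeights N lam) (alphaN N lam)) ∧
    StrictAntiOn (alphaN N) (Set.Icc 0 1) ∧
    Set.BijOn (alphaN N) (Set.Icc 0 1) (Set.Icc 0 1) ∧
    StrictAntiOn (beta N 0 1) (Set.Icc 0 1) ∧
    Set.BijOn (beta N 0 1) (Set.Icc 0 1) (Set.Icc 0 1) ∧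
    Set.BijOn (upperN N) (Set.Icc 0 1) (Set.Icc 0 1) ∧
    -- common asymptotic form of both curves as `α → 1`
    ((fun α : ℝ => unitInv (alphaN N) α - kN N * √(1 - α)) =O[𝓝[≤] 1] fun α : ℝ => 1 - α) ∧
    ((fun α : ℝ => unitInv (upperN N) α - kN N * √(1 - α)) =O[𝓝[≤] 1] fun α : ℝ => 1 - α) ∧
    -- explicit error bound
    (∀ α : ℝ, 0 < α → α ≤ 1 →
      |unitInv (alphaN N) α - kN N * √(1 - α)|
        ≤ 1 - α + 3 / 2 * kN N * ((1 - α) / α) ^ (3 / 2 : ℝ)) ∧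
    -- lower bound for the true curve, and the incoherent instruments realising it
    (N ≠ 2 → ∀ α ∈ Set.Icc (0 : ℝ) 1,
      uN N 0 α + uN N 1 α ≤ unitInv (alphaN N) α ∧
      ∃ I : Fin (N + 1) → (Matrix (Fin N → Fin 2) (Fin N → Fin 2) ℂ →ₗ[ℂ]
          Matrix (Fin N → Fin 2) (Fin N → Fin 2) ℂ),
        IsGII I ∧ HasCoherenceMatrix I (spinBoson N (uN N 0 α + uN N 1 α)) ∧
          Measures I (dfsMix N α)) := by
  refine ⟨fun lam hl => isGreatest_alphaN N hl, strictAntiOn_alphaN hN, bijOn_alphaN hN,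
    strictAntiOn_beta hN, bijOn_beta hN, bijOn_unitInv (bijOn_beta hN), isBigO_unitInv_alphaN hN,
    isBigO_unitInv_upperN hN, fun α h0 h1 => abs_unitInv_alphaN_sub_le hN h0 h1, fun hN2 α hα => ?_⟩
  have hsplit := splits_uN_add_uN hN hN2 hα
  exact ⟨hsplit.le_unitInv_alphaN hN hα (uN_add_uN_mem_Icc hN hα),
    exists_isGII_of_mem_compatSet (mem_compatWeights_iff.2 ⟨hα, hsplit⟩).2⟩
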